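/- **Setting.** Let $E,A\in\mathbb C^{n\times n}$ with $E=E^H\ge 0$ and $A$ semi-dissipative, i.e. $A=J-R$ with $J=\tfrac12(A-A^H)$ and $R=-\tfrac12(A+A^H)\ge 0$ (so $E\dot x=Ax$ is a semi-dissipative Hamiltonian DAE). A *staircase form* of $(E,J,R)$ is given by a unitary $P$ with, for block sizes $n_1,n_2,n_3,n_4=n_1,n_5\ge 0$, $$PEP^H=\begin{bmatrix}E_{11}&E_{21}^H&0&0&0\\E_{21}&E_{22}&0&0&0\\0&0&0&0&0\\0&0&0&0&0\\0&0&0&0&0\end{bmatrix},\quad PJP^H=\begin{bmatrix}J_{11}&-J_{21}^H&-J_{31}^H&-J_{41}^H&0\\J_{21}&J_{22}&-J_{32}^H&0&0\\J_{31}&J_{32}&J_{33}&0&0\\J_{41}&0&0&0&0\\0&0&0&0&0\end{bmatrix},\quad PRP^H=\begin{bmatrix}R_{11}&R_{21}^H&R_{31}^H&0&0\\R_{21}&R_{22}&R_{32}^H&0&0\\R_{31}&R_{32}&R_{33}&0&0\\0&0&0&0&0\\0&0&0&0&0\end{bmatrix},$$ where $E_{11}$, $E_{22}$ and $\begin{bmatrix}E_{11}&E_{21}^H\\E_{21}&E_{22}\end{bmatrix}$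 are positive definite and $J_{41}$, $J_{33}-R_{33}$ are invertible (blocks of size $0$ are absent). Put $\check A=P(J-R)P^H$ and $S_{22}=\check A_{22}-\check A_{23}\check A_{33}^{-1}\check A_{32}$. The *HC-index* of a semi-dissipative matrix $J'-R'$ is the least $m\ge 0$ with $\sum_{j=0}^m J'^jR'(J'^H)^j>0$, and $\infty$ if there is none. The HC-index of a regular pencil $\lambda E-A$ is that of $E_{22}^{-1/2}S_{22}E_{22}^{-1/2}$, and $0$ if $n_2=0$; it does not depend on the staircase form. An *almost Kronecker form* of a staircase form is given by nonsingular $L,Z$ such that $$L\,PEP^H Z=\operatorname{diag}(\widehat E_{11},\widehat E_{22},0,0,0),\qquad L\,\check A\, Z=\begin{bmatrix}0&0&0&I&0\\0&\widehat A_{22}&0&0&0\\0&0&I&0&0\\-I&0&0&0&0\\0&0&0&0&0\end{bmatrix},$$ with $\widehat E_{11},\widehat E_{22}$ Hermitian positive definite. **Theorem.** Assume that the pencil $\lambda E-A$ is regular and has finite HC-index, and consider the generalized Lyapunov equation $$E^HXA+A^HXE=-E^HWE .\tag{1}$$ 1. For every $W\in\mathbb C^{n\times n}$, equation (1) has a solution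 $X\in\mathbb C^{n\times n}$. 2. For given $W$, the matrix $E^HXE$ is the same for all solutions $X$ of (1). 3. Let $P_l$ be the spectral projection onto the left deflating subspace associated with the finite eigenvalues of $\lambda E-A$: the unique matrix $P_l=U\operatorname{diag}(I,0)U^{-1}$, where $E=U\operatorname{diag}(I,N)T$, $A=U\operatorname{diag}(\Lambda,I)T$ with $U,T$ invertible and $N$ nilpotent. If $W$ is positive semidefinite, then every solution $X$ of (1) satisfies $x^HXx\ge 0$ for all $x\in\operatorname{im}P_l$; if $W$ is positive definite, then $x^HXx>0$ for all $0\ne x\in\operatorname{im}P_l$. 4. The triple $(E,J,R)$ has a staircase form; every staircase form has $n_5=0$ and admits an almost Kronecker form. Given any staircase form and any almost Kronecker form of it, let $\widehat W=Z^HPE^HWEP^HZ$, partitioned into $4\times4$ blocks. Then: * The equation $$\widehat E_{22}Y_{22}\widehat A_{22}+\widehat A_{22}^HY_{22}\widehat E_{22}=-\widehat W_{22}\tag{2}$$ has exactly one solution $Y_{22}$; it is positive (semi)definite if $W$ is. * $X$ solves (1) if and only if $$X=P^HL^H\begin{bmatrix}0&0&0&Y_{14}\\0&Y_{22}&0&Y_{24}\\0&0&Y_{33}&Y_{34}\\Y_{41}&Y_{42}&Y_{43}&Y_{44}\end{bmatrix}LP$$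 for arbitrary $Y_{33},Y_{34},Y_{43},Y_{44}$, with $Y_{22}$ the solution of (2), $Y_{24}=\widehat E_{22}^{-1}\widehat W_{21}$, $Y_{42}=\widehat W_{12}\widehat E_{22}^{-1}$, and any $Y_{14},Y_{41}$ with $\widehat E_{11}Y_{14}+Y_{41}\widehat E_{11}=\widehat W_{11}$. * If $W$ is Hermitian, the Hermitian solutions of (1) are exactly the matrices of this form with $Y_{22}$, $Y_{33}$, $Y_{44}$ Hermitian, $Y_{41}=Y_{14}^H$, $Y_{42}=Y_{24}^H$, $Y_{43}=Y_{34}^H$ (so that the condition on $Y_{14}$ reads $\widehat E_{11}Y_{14}+Y_{14}^H\widehat E_{11}=\widehat W_{11}$). Among the admissible $Y_{14}$ there is exactly one Hermitian matrix; it is positive (semi)definite if $W$ is. -/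

import Mathlib

open Matrix
open scoped ComplexOrder MatrixOrder

namespace DHDAE

noncomputable section

/-- The Hermitian part `(A + Aᴴ) / 2`. -/
def hermPart {n : ℕ} (A : Matrix (Fin n) (Fin n) ℂ) : Matrix (Fin n) (Fin n) ℂ :=
  (1 / 2 : ℂ) • (A + Aᴴ)

/-- The skew-Hermitian part `(A - Aᴴ) / 2`. -/
def skewPart {n : ℕ} (A : Matrix (Fin n) (Fin n) ℂ) : Matrix (Fin n) (Fin n) ℂ :=
  (1 / 2 : ℂ) • (A - Aᴴ)

/-- `A` is semi-dissipative: its Hermitian part is negative semi-definite. -/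
def SemiDissipative {n : ℕ} (A : Matrix (Fin n) (Fin n) ℂ) : Prop :=
  (-hermPart A).PosSemidef

/-- The DAE `E x' = A x` is a semi-dissipative Hamiltonian DAE. -/
def IsSemiDissipativeHamiltonian {n : ℕ} (E A : Matrix (Fin n) (Fin n) ℂ) : Prop :=
  E.PosSemidef ∧ SemiDissipative A

/-- The pencil `λ E - A` is regular. -/
def RegularPencil {n : ℕ} (E A : Matrix (Fin n) (Fin n) ℂ) : Prop :=
  ∃ z : ℂ, (z • E - A).det ≠ 0

/-! ### Block matrices -/

/-- Indices of a matrix partitioned with block sizes `n₁, n₂, n₃, n₄ = n₁`. -/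
abbrev Idx4 (n₁ n₂ n₃ : ℕ) : Type := (Fin n₁ ⊕ Fin n₂) ⊕ (Fin n₃ ⊕ Fin n₁)

/-- Indices of a matrix partitioned with block sizes `n₁, n₂, n₃, n₄ = n₁, n₅`. -/
abbrev Idx5 (n₁ n₂ n₃ n₅ : ℕ) : Type := Idx4 n₁ n₂ n₃ ⊕ Fin n₅

/-- The four-by-four block matrix with the given blocks, listed row by row. -/
def blocks4 {n₁ n₂ n₃ : ℕ}
    (M11 : Matrix (Fin n₁) (Fin n₁) ℂ) (M12 : Matrix (Fin n₁) (Fin n₂) ℂ)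
    (M13 : Matrix (Fin n₁) (Fin n₃) ℂ) (M14 : Matrix (Fin n₁) (Fin n₁) ℂ)
    (M21 : Matrix (Fin n₂) (Fin n₁) ℂ) (M22 : Matrix (Fin n₂) (Fin n₂) ℂ)
    (M23 : Matrix (Fin n₂) (Fin n₃) ℂ) (M24 : Matrix (Fin n₂) (Fin n₁) ℂ)
    (M31 : Matrix (Fin n₃) (Fin n₁) ℂ) (M32 : Matrix (Fin n₃) (Fin n₂) ℂ)
    (M33 : Matrix (Fin n₃) (Fin n₃) ℂ) (M34 : Matrix (Fin n₃) (Fin n₁) ℂ)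
    (M41 : Matrix (Fin n₁) (Fin n₁) ℂ) (M42 : Matrix (Fin n₁) (Fin n₂) ℂ)
    (M43 : Matrix (Fin n₁) (Fin n₃) ℂ) (M44 : Matrix (Fin n₁) (Fin n₁) ℂ) :
    Matrix (Idx4 n₁ n₂ n₃) (Idx4 n₁ n₂ n₃) ℂ :=
  fromBlocks
    (fromBlocks M11 M12 M21 M22) (fromBlocks M13 M14 M23 M24)
    (fromBlocks M31 M32 M41 M42) (fromBlocks M33 M34 M43 M44)

/-- Border a four-by-four block matrix by a zero fifth block row and block column. -/
def border {n₁ n₂ n₃ : ℕ} (n₅ : ℕ) (M : Matrix (Idx4 n₁ n₂ n₃) (Idx4 n₁ n₂ n₃) ℂ) :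
    Matrix (Idx5 n₁ n₂ n₃ n₅) (Idx5 n₁ n₂ n₃ n₅) ℂ :=
  fromBlocks M 0 0 0

/-! ### Hypocoercivity index -/

/-- The hypocoercivity index of a semi-dissipative matrix `A = J - R` with `J` its skew-Hermitian
part and `-R` its Hermitian part: the least `m` with `∑_{j ≤ m} Jʲ R (Jᴴ)ʲ` positive definite, and
`⊤` if there is none. (For the matrix of size zero it equals `0`.) -/
def matrixHCIndex {n : ℕ} (A : Matrix (Fin n) (Fin n) ℂ) : ℕ∞ :=
  ⨅ (m : ℕ) (_ : (∑ j ∈ Finset.range (m + 1),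
    skewPart A ^ j * (-hermPart A) * (skewPart A)ᴴ ^ j).PosDef), (m : ℕ∞)

/-- A staircase form of the triple `(E, J, R)`: a unitary `P` which brings the three matrices
simultaneously to block form, with block sizes `n₁, n₂, n₃, n₁, n₅`. Any of the sizes may be zero,
in which case the corresponding blocks are absent. -/
structure StaircaseForm {n : ℕ} (E J R : Matrix (Fin n) (Fin n) ℂ) where
  (n₁ n₂ n₃ n₅ : ℕ)
  P : Matrix (Idx5 n₁ n₂ n₃ n₅) (Fin n) ℂ
  mul_conjTranspose : P * Pᴴ = 1
  conjTranspose_mul : Pᴴ * P = 1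
  E11 : Matrix (Fin n₁) (Fin n₁) ℂ
  E21 : Matrix (Fin n₂) (Fin n₁) ℂ
  E22 : Matrix (Fin n₂) (Fin n₂) ℂ
  J11 : Matrix (Fin n₁) (Fin n₁) ℂ
  J21 : Matrix (Fin n₂) (Fin n₁) ℂ
  J22 : Matrix (Fin n₂) (Fin n₂) ℂ
  J31 : Matrix (Fin n₃) (Fin n₁) ℂ
  J32 : Matrix (Fin n₃) (Fin n₂) ℂ
  J33 : Matrix (Fin n₃) (Fin n₃) ℂ
  J41 : Matrix (Fin n₁) (Fin n₁) ℂ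
  R11 : Matrix (Fin n₁) (Fin n₁) ℂ
  R21 : Matrix (Fin n₂) (Fin n₁) ℂ
  R22 : Matrix (Fin n₂) (Fin n₂) ℂ
  R31 : Matrix (Fin n₃) (Fin n₁) ℂ
  R32 : Matrix (Fin n₃) (Fin n₂) ℂ
  R33 : Matrix (Fin n₃) (Fin n₃) ℂ
  E_eq : P * E * Pᴴ = border n₅ (blocks4
    E11 E21ᴴ 0 0
    E21 E22  0 0
    0   0    0 0
    0   0    0 0)
  J_eq : P * J * Pᴴ = border n₅ (blocks4
    J11 (-J21ᴴ) (-J31ᴴ) (-J41ᴴ)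
    J21 J22     (-J32ᴴ) 0
    J31 J32     J33     0
    J41 0       0       0)
  R_eq : P * R * Pᴴ = border n₅ (blocks4
    R11 R21ᴴ R31ᴴ 0
    R21 R22  R32ᴴ 0
    R31 R32  R33  0
    0   0    0    0)
  E_posDef : (fromBlocks E11 E21ᴴ E21 E22).PosDef
  E11_posDef : E11.PosDef
  E22_posDef : E22.PosDef
  J41_isUnit : IsUnit J41
  A33_isUnit : IsUnit (J33 - R33)

namespace StaircaseForm

variable {n : ℕ} {E J R : Matrix (Fin n) (Fin n) ℂ}

/-- The matrix `Â₂₂ = Ǎ₂₂ - Ǎ₂₃ Ǎ₃₃⁻¹ Ǎ₃₂`, where `Ǎ = P (J - R) Pᴴ`, of the underlying implicit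
ODE `E₂₂ y₂' = Â₂₂ y₂`. -/
def A22Schur (S : StaircaseForm E J R) : Matrix (Fin S.n₂) (Fin S.n₂) ℂ :=
  (S.J22 - S.R22) - (-S.J32ᴴ - S.R32ᴴ) * (S.J33 - S.R33)⁻¹ * (S.J32 - S.R32)

/-- The hypocoercivity index read off from a staircase form: the index of the matrix
`E₂₂^{-1/2} Â₂₂ E₂₂^{-1/2}`. It is `0` for trivial dynamics, that is, for `n₂ = 0`. -/
def hcIndex (S : StaircaseForm E J R) : ℕ∞ :=
  matrixHCIndex ((CFC.sqrt S.E22)⁻¹ * S.A22Schur * (CFC.sqrt S.E22)⁻¹)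

end StaircaseForm

/-- Staircase forms of the pencil `λ E - A`, with `A = J - R` split into its skew-Hermitian part
`J` and its Hermitian part `-R`. -/
abbrev PencilStaircaseForm {n : ℕ} (E A : Matrix (Fin n) (Fin n) ℂ) : Type :=
  StaircaseForm E (skewPart A) (-hermPart A)

/-- The hypocoercivity index of a regular semi-dissipative Hamiltonian pencil `λ E - A`. Any two
staircase forms differ by a block diagonal unitary matrix and give the same index, so the infimum
is over a single value. -/
def hcIndex {n : ℕ} (E A : Matrix (Fin n) (Fin n) ℂ) : ℕ∞ :=
  ⨅ S : PencilStaircaseForm E A, S.hcIndex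

/-! ### Almost Kronecker canonical form -/

/-- Nonsingular matrices `L, Z` which bring a staircase form to almost Kronecker canonical
form. -/
structure AlmostKroneckerForm {n : ℕ} {E J R : Matrix (Fin n) (Fin n) ℂ}
    (S : StaircaseForm E J R) where
  L : Matrix (Idx5 S.n₁ S.n₂ S.n₃ S.n₅) (Idx5 S.n₁ S.n₂ S.n₃ S.n₅) ℂ
  Z : Matrix (Idx5 S.n₁ S.n₂ S.n₃ S.n₅) (Idx5 S.n₁ S.n₂ S.n₃ S.n₅) ℂ
  L_isUnit : IsUnit L
  Z_isUnit : IsUnit Z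
  E11 : Matrix (Fin S.n₁) (Fin S.n₁) ℂ
  E22 : Matrix (Fin S.n₂) (Fin S.n₂) ℂ
  A22 : Matrix (Fin S.n₂) (Fin S.n₂) ℂ
  E11_posDef : E11.PosDef
  E22_posDef : E22.PosDef
  E_eq : L * (S.P * E * S.Pᴴ) * Z = border S.n₅ (blocks4
    E11 0   0 0
    0   E22 0 0
    0   0   0 0
    0   0   0 0)
  A_eq : L * (S.P * (J - R) * S.Pᴴ) * Z = border S.n₅ (blocks4
    0    0   0 1
    0    A22 0 0
    0    0   1 0
    (-1) 0   0 0)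

/-! ### The generalized Lyapunov equation -/

/-- `X` solves `Eᴴ X A + Aᴴ X E = -Eᴴ W E`. -/
def GenLyapunov {n : ℕ} (E A W X : Matrix (Fin n) (Fin n) ℂ) : Prop :=
  Eᴴ * X * A + Aᴴ * X * E = -(Eᴴ * W * E)

namespace AlmostKroneckerForm

variable {n : ℕ} {E J R : Matrix (Fin n) (Fin n) ℂ} {S : StaircaseForm E J R}

/-- The transformed right-hand side `Ŵ = Zᴴ P Eᴴ W E Pᴴ Z`. -/
def What (K : AlmostKroneckerForm S) (W : Matrix (Fin n) (Fin n) ℂ) :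
    Matrix (Idx5 S.n₁ S.n₂ S.n₃ S.n₅) (Idx5 S.n₁ S.n₂ S.n₃ S.n₅) ℂ :=
  K.Zᴴ * S.P * Eᴴ * W * E * S.Pᴴ * K.Z

/-- The block `Ŵ₁₁`. -/
def W11 (K : AlmostKroneckerForm S) (W : Matrix (Fin n) (Fin n) ℂ) :
    Matrix (Fin S.n₁) (Fin S.n₁) ℂ :=
  (K.What W).toBlocks₁₁.toBlocks₁₁.toBlocks₁₁

/-- The block `Ŵ₁₂`. -/
def W12 (K : AlmostKroneckerForm S) (W : Matrix (Fin n) (Fin n) ℂ) :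
    Matrix (Fin S.n₁) (Fin S.n₂) ℂ :=
  (K.What W).toBlocks₁₁.toBlocks₁₁.toBlocks₁₂

/-- The block `Ŵ₂₁`. -/
def W21 (K : AlmostKroneckerForm S) (W : Matrix (Fin n) (Fin n) ℂ) :
    Matrix (Fin S.n₂) (Fin S.n₁) ℂ :=
  (K.What W).toBlocks₁₁.toBlocks₁₁.toBlocks₂₁

/-- The block `Ŵ₂₂`. -/
def W22 (K : AlmostKroneckerForm S) (W : Matrix (Fin n) (Fin n) ℂ) :
    Matrix (Fin S.n₂) (Fin S.n₂) ℂ :=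
  (K.What W).toBlocks₁₁.toBlocks₁₁.toBlocks₂₂

/-- The Lyapunov equation `Ê₂₂ Y₂₂ Â₂₂ + Â₂₂ᴴ Y₂₂ Ê₂₂ = -Ŵ₂₂` of the dynamic part. -/
def SolvesDyn (K : AlmostKroneckerForm S) (W : Matrix (Fin n) (Fin n) ℂ)
    (Y22 : Matrix (Fin S.n₂) (Fin S.n₂) ℂ) : Prop :=
  K.E22 * Y22 * K.A22 + K.A22ᴴ * Y22 * K.E22 = -K.W22 W

/-- Transform back: `X = Pᴴ Lᴴ Y L P`. -/
def back (K : AlmostKroneckerForm S)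
    (Y : Matrix (Idx4 S.n₁ S.n₂ S.n₃) (Idx4 S.n₁ S.n₂ S.n₃) ℂ) :
    Matrix (Fin n) (Fin n) ℂ :=
  S.Pᴴ * K.Lᴴ * border S.n₅ Y * K.L * S.P

end AlmostKroneckerForm

/-! ### Spectral projection and definiteness on a subspace -/

/-- `Pl` is the spectral projection onto the left deflating subspace of `λ E - A` associated with
its finite eigenvalues: in a Weierstrass decomposition
`E = U diag(I, N) T`, `A = U diag(Λ, I) T` with `U, T` invertible and `N` nilpotent (so that the
finite eigenvalues are those of `Λ`), it is `Pl = U diag(I, 0) U⁻¹`. -/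
def IsLeftSpectralProjection {n : ℕ} (E A Pl : Matrix (Fin n) (Fin n) ℂ) : Prop :=
  ∃ (k l : ℕ)
    (U : Matrix (Fin n) (Fin k ⊕ Fin l) ℂ) (U' : Matrix (Fin k ⊕ Fin l) (Fin n) ℂ)
    (T : Matrix (Fin k ⊕ Fin l) (Fin n) ℂ) (T' : Matrix (Fin n) (Fin k ⊕ Fin l) ℂ)
    (Λ : Matrix (Fin k) (Fin k) ℂ) (N : Matrix (Fin l) (Fin l) ℂ),
    U * U' = 1 ∧ U' * U = 1 ∧ T * T' = 1 ∧ T' * T = 1 ∧ IsNilpotent N ∧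
    E = U * (fromBlocks 1 0 0 N : Matrix (Fin k ⊕ Fin l) (Fin k ⊕ Fin l) ℂ) * T ∧
    A = U * (fromBlocks Λ 0 0 1 : Matrix (Fin k ⊕ Fin l) (Fin k ⊕ Fin l) ℂ) * T ∧
    Pl = U * (fromBlocks 1 0 0 0 : Matrix (Fin k ⊕ Fin l) (Fin k ⊕ Fin l) ℂ) * U'

/-- The image of a matrix. -/
def image {n : ℕ} (M : Matrix (Fin n) (Fin n) ℂ) : Submodule ℂ (Fin n → ℂ) :=
  LinearMap.range M.mulVecLin

/-- `xᴴ X x` is real and nonnegative for all `x` in the subspace. -/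
def PosSemidefOn {n : ℕ} (X : Matrix (Fin n) (Fin n) ℂ) (V : Submodule ℂ (Fin n → ℂ)) : Prop :=
  ∀ x ∈ V, 0 ≤ star x ⬝ᵥ (X *ᵥ x)

/-- `xᴴ X x` is real and positive for all nonzero `x` in the subspace. -/
def PosDefOn {n : ℕ} (X : Matrix (Fin n) (Fin n) ℂ) (V : Submodule ℂ (Fin n → ℂ)) : Prop :=
  ∀ x ∈ V, x ≠ 0 → 0 < star x ⬝ᵥ (X *ᵥ x)

end

end DHDAE

/-! Everything rests on asymptotic stability: a finite HC-index forces all finite eigenvalues of the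
pencil into the open left half-plane (`pencilStable_of_hcIndex`). Suppose a semi-dissipative J' - R'
has an eigenvector v with eigenvalue z, Re z ≥ 0. Then vᴴR'v = -(Re z)|v|² forces R'v = 0, so v is
an eigenvector of J' and is annihilated by every J'ʲR'(J'ᴴ)ʲ; no partial sum is definite. This is
applied to E₂₂^{-1/2} S₂₂ E₂₂^{-1/2}, which is similar to E₂₂⁻¹S₂₂, the dynamic part of the pencil.
Stability is intrinsic to the pencil, so it passes from one staircase form of finite index to every
almost Kronecker form of every staircase form (`pencilStable_iff`).

In almost Kronecker coordinates equation (1) splits into block equations (`genLyapunov_back_iff`):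
seven blocks of Y vanish, four are free, Y₂₄ and Y₄₂ are explicit, Y₁₄ and Y₄₁ share one linear
equation, and Y₂₂ solves (2). The matrix EᴴXE sees only Y₂₂. With Q = Ê₂₂Y₂₂Ê₂₂, equation (2)
becomes QB + BᴴQ = -Ŵ₂₂ for the Hurwitz matrix B = Ê₂₂⁻¹Â₂₂; the equation for a Hermitian Y₁₄ is of
the same kind with B = -Ê₁₁. Restricting (1) to the deflating subspace of the finite eigenvalues
again gives a Lyapunov equation with Hurwitz coefficient
(`IsLeftSpectralProjection.exists_lyapunov`), whence the definiteness on im Pₗ.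

Lyapunov theory itself is reduced to discrete time: for C = (B+1)(B-1)⁻¹ the equation becomes Y = V
+ CᴴYC with V congruent to 2W, and Cᵏ → 0.

A staircase form is built from K = ker E and K₄ = {x ∈ K : Ax ⊥ K}, using the orthogonal pieces AK₄,
its complement in Kᗮ, the complement of K₄ in K, and K₄ (`nonempty_pencilStaircaseForm`). -/

namespace DHDAE

open Filter Topology

/-! ### Lyapunov equations with Hurwitz coefficient, via the Cayley transform -/

section Lyapunov

variable {m : Type*} [Fintype m] [DecidableEq m]

/-- All eigenvalues of `B` lie in the open left half-plane. -/
def IsHurwitz (B : Matrix m m ℂ) : Prop :=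
  ∀ (z : ℂ) (v : m → ℂ), v ≠ 0 → B *ᵥ v = z • v → z.re < 0

theorem exists_mulVec_eq_smul_of_mem_spectrum {C : Matrix m m ℂ} {z : ℂ}
    (hz : z ∈ spectrum ℂ C) : ∃ v : m → ℂ, v ≠ 0 ∧ C *ᵥ v = z • v := by
  rw [spectrum.mem_iff, Matrix.isUnit_iff_isUnit_det, isUnit_iff_ne_zero, not_not] at hz
  obtain ⟨v, hv, h⟩ := Matrix.exists_mulVec_eq_zero_iff.2 hz
  refine ⟨v, hv, ?_⟩
  rw [sub_mulVec, sub_eq_zero, Algebra.algebraMap_eq_smul_one, smul_mulVec, one_mulVec] at h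
  exact h.symm

/-- Gelfand's formula: for r strictly between the spectral radius and 1, eventually ‖Cᵏ‖ ≤ rᵏ. -/
theorem tendsto_pow_of_norm_eigenvalue_lt_one {C : Matrix m m ℂ}
    (hC : ∀ (z : ℂ) (v : m → ℂ), v ≠ 0 → C *ᵥ v = z • v → ‖z‖ < 1) :
    Tendsto (fun k : ℕ => C ^ k) atTop (𝓝 0) := by
  let _ : NormedRing (Matrix m m ℂ) := Matrix.linftyOpNormedRing
  let _ : NormedAlgebra ℂ (Matrix m m ℂ) := Matrix.linftyOpNormedAlgebra
  have _ : CompleteSpace (Matrix m m ℂ) := FiniteDimensional.complete ℂ _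
  -- The strict bound on the spectral radius uses that it is attained on a nonempty spectrum, so
  -- size zero is treated apart.
  rcases isEmpty_or_nonempty m with h | h
  · exact tendsto_const_nhds.congr fun k => Subsingleton.elim _ _
  have hr : spectralRadius ℂ C < 1 := by
    have := spectrum.spectralRadius_lt_of_forall_lt C (r := 1) fun z hz => by
      obtain ⟨v, hv, h⟩ := exists_mulVec_eq_smul_of_mem_spectrum hz
      exact_mod_cast hC z v hv h
    exact_mod_cast this
  obtain ⟨r, hr1, hr2⟩ := ENNReal.lt_iff_exists_nnreal_btwn.1 hr
  have hlt := (spectrum.pow_nnnorm_pow_one_div_tendsto_nhds_spectralRadius C).eventually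
    (gt_mem_nhds hr1)
  have hr3 : r < 1 := by exact_mod_cast hr2
  apply squeeze_zero_norm' _ (tendsto_pow_atTop_nhds_zero_of_lt_one r.2 hr3)
  filter_upwards [hlt, eventually_gt_atTop 0] with k hk hk0
  have h1 := ENNReal.rpow_le_rpow hk.le (z := k) (by positivity)
  rw [← ENNReal.rpow_mul, one_div, inv_mul_cancel₀ (by positivity), ENNReal.rpow_one,
    ENNReal.rpow_natCast] at h1
  exact_mod_cast h1

variable {B Y W : Matrix m m ℂ}

theorem IsHurwitz.isUnit_sub_one (hB : IsHurwitz B) : IsUnit (B - 1) := by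
  rw [Matrix.isUnit_iff_isUnit_det, isUnit_iff_ne_zero]
  intro h0
  obtain ⟨v, hv, h⟩ := Matrix.exists_mulVec_eq_zero_iff.2 h0
  have := hB 1 v hv (by rwa [sub_mulVec, sub_eq_zero, one_mulVec, ← one_smul ℂ v,
    mulVec_smul, one_smul ℂ (B *ᵥ v)] at h)
  norm_num at this

/-- The Cayley transform of `B`. -/
noncomputable def cayley (B : Matrix m m ℂ) : Matrix m m ℂ := (B + 1) * (B - 1)⁻¹

/-- The Cayley transform maps the open left half-plane into the open unit disc. An eigenvector
(B-1)y of `cayley B` with eigenvalue z yields By = ((z+1)/(z-1))y, whose eigenvalue has real part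
(|z|²-1)/|z-1|². -/
theorem IsHurwitz.tendsto_cayley_pow (hB : IsHurwitz B) :
    Tendsto (fun k : ℕ => cayley B ^ k) atTop (𝓝 0) := by
  refine tendsto_pow_of_norm_eigenvalue_lt_one fun z v hv h => ?_
  have hu := (Matrix.isUnit_iff_isUnit_det _).1 hB.isUnit_sub_one
  obtain ⟨y, rfl⟩ : ∃ y, v = (B - 1) *ᵥ y :=
    ⟨(B - 1)⁻¹ *ᵥ v, by rw [mulVec_mulVec, mul_nonsing_inv _ hu, one_mulVec]⟩
  have hy : y ≠ 0 := by rintro rfl; simp at hv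
  rw [cayley, ← mulVec_mulVec, mulVec_mulVec _ (B - 1)⁻¹, nonsing_inv_mul _ hu, one_mulVec,
    add_mulVec, sub_mulVec, one_mulVec] at h
  by_contra! hz
  have hz1 : z - 1 ≠ 0 := by
    intro hz1
    rw [sub_eq_zero] at hz1
    subst hz1
    apply hy
    ext i
    have := congrFun h i
    simp at this ⊢
    linear_combination (1 / 2 : ℂ) * this
  have h2 := hB ((z + 1) / (z - 1)) y hy (by
    ext i
    have := congrFun h i
    simp at this ⊢
    field_simp
    linear_combination -this)
  rw [Complex.div_re, ← add_div, div_lt_iff₀ (Complex.normSq_pos.2 hz1)] at h2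
  have h3 : 1 ≤ Complex.normSq z := by
    rw [Complex.normSq_eq_norm_sq]; nlinarith
  rw [Complex.normSq_apply] at h3
  simp at h2
  nlinarith

/-- The identity (B-1)ᴴY(B-1) - (B+1)ᴴY(B+1) = -2(YB + BᴴY), multiplied by (B-1)⁻¹ on the right and
its adjoint on the left, turns the Lyapunov equation into a Stein equation. -/
theorem cayley_stein (hu : IsUnit (B - 1)) (h : Y * B + Bᴴ * Y = -W) :
    Y = 2 • ((B - 1)⁻¹ᴴ * W * (B - 1)⁻¹) + (cayley B)ᴴ * Y * cayley B := by
  have hu := (Matrix.isUnit_iff_isUnit_det _).1 hu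
  have h1 : (B - 1)ᴴ * Y * (B - 1) = 2 • W + (B + 1)ᴴ * Y * (B + 1) := by
    rw [← neg_eq_iff_eq_neg.2 h]
    simp only [conjTranspose_sub, conjTranspose_add, conjTranspose_one]
    noncomm_ring
  have h2 : Y = (B - 1)⁻¹ᴴ * ((B - 1)ᴴ * Y * (B - 1)) * (B - 1)⁻¹ := by
    have h3 : (B - 1)⁻¹ᴴ * (B - 1)ᴴ = 1 := by
      rw [← conjTranspose_mul, mul_nonsing_inv _ hu, conjTranspose_one]
    calc Y = ((B - 1)⁻¹ᴴ * (B - 1)ᴴ) * Y * ((B - 1) * (B - 1)⁻¹) := by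
          rw [h3, mul_nonsing_inv _ hu, one_mul, mul_one]
      _ = _ := by noncomm_ring
  conv_lhs => rw [h2, h1]
  rw [cayley, conjTranspose_mul]
  simp only [mul_add, add_mul, mul_assoc, mul_smul_comm, smul_mul_assoc]

theorem IsHurwitz.tendsto_conj_cayley (hB : IsHurwitz B) (Y : Matrix m m ℂ) :
    Tendsto (fun k : ℕ => (cayley B ^ k)ᴴ * Y * cayley B ^ k) atTop (𝓝 0) := by
  have h1 := hB.tendsto_cayley_pow
  have hc : Continuous fun C : Matrix m m ℂ => Cᴴ * Y * C := by fun_prop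
  have := (hc.tendsto 0).comp h1
  rwa [conjTranspose_zero, zero_mul, zero_mul] at this

/-- The homogeneous Stein equation iterates to Y = (Cᵏ)ᴴYCᵏ for all k, and the right-hand side tends
to 0. -/
theorem IsHurwitz.eq_zero_of_lyapunov (hB : IsHurwitz B) (h : Y * B + Bᴴ * Y = 0) : Y = 0 := by
  have h1 := cayley_stein hB.isUnit_sub_one (W := 0) (by simpa using h)
  simp only [mul_zero, zero_mul, smul_zero, zero_add] at h1
  have h2 : ∀ k : ℕ, (cayley B ^ k)ᴴ * Y * cayley B ^ k = Y := by
    intro k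
    induction k with
    | zero => simp
    | succ k ih =>
      rw [pow_succ, conjTranspose_mul]
      calc _ = (cayley B)ᴴ * ((cayley B ^ k)ᴴ * Y * cayley B ^ k) * cayley B := by noncomm_ring
        _ = Y := by rw [ih, ← h1]
  exact tendsto_nhds_unique (tendsto_const_nhds.congr fun k => (h2 k).symm)
    (hB.tendsto_conj_cayley Y)

/-- An injective endomorphism of a finite-dimensional space is surjective, so uniqueness gives
existence. -/
theorem IsHurwitz.existsUnique_lyapunov (hB : IsHurwitz B) (W : Matrix m m ℂ) :
    ∃! Y : Matrix m m ℂ, Y * B + Bᴴ * Y = -W := by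
  let f : Matrix m m ℂ →ₗ[ℂ] Matrix m m ℂ :=
    LinearMap.mulRight ℂ B + LinearMap.mulLeft ℂ Bᴴ
  have hf : ∀ Y, f Y = Y * B + Bᴴ * Y := fun Y => rfl
  have hinj : Function.Injective f := by
    rw [injective_iff_map_eq_zero]
    exact fun Y hY => hB.eq_zero_of_lyapunov hY
  obtain ⟨Y, hY⟩ := LinearMap.surjective_of_injective hinj (-W)
  exact ⟨Y, hY, fun Y' hY' => hinj (hY'.trans hY.symm)⟩

theorem IsHurwitz.isHermitian_of_lyapunov (hB : IsHurwitz B) (hW : W.IsHermitian)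
    (h : Y * B + Bᴴ * Y = -W) : Y.IsHermitian := by
  refine (hB.existsUnique_lyapunov W).unique ?_ h
  have := congrArg conjTranspose h
  rw [conjTranspose_add, conjTranspose_mul, conjTranspose_mul, conjTranspose_conjTranspose,
    conjTranspose_neg, hW.eq] at this
  rw [← this, add_comm]

/-- Iterating the Stein equation makes Y - (Cᵏ)ᴴYCᵏ a sum of congruences of V ≥ 0; these positive
semidefinite matrices converge to Y. -/
theorem IsHurwitz.posSemidef_of_lyapunov (hB : IsHurwitz B) (hW : W.PosSemidef)
    (h : Y * B + Bᴴ * Y = -W) : Y.PosSemidef := by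
  refine .of_dotProduct_mulVec_nonneg (hB.isHermitian_of_lyapunov hW.1 h) fun x => ?_
  have hs := cayley_stein hB.isUnit_sub_one h
  set V := 2 • ((B - 1)⁻¹ᴴ * W * (B - 1)⁻¹) with hV
  have hVp : V.PosSemidef := by
    rw [hV, two_smul]
    exact (hW.conjTranspose_mul_mul_same _).add (hW.conjTranspose_mul_mul_same _)
  have h2 : ∀ k : ℕ, (Y - (cayley B ^ k)ᴴ * Y * cayley B ^ k).PosSemidef := by
    intro k
    induction k with
    | zero => simpa using PosSemidef.zero
    | succ k ih =>
      have e : Y - (cayley B ^ (k + 1))ᴴ * Y * cayley B ^ (k + 1) =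
          V + (cayley B)ᴴ * (Y - (cayley B ^ k)ᴴ * Y * cayley B ^ k) * cayley B := by
        conv_lhs => enter [1]; rw [hs]
        rw [pow_succ, conjTranspose_mul]
        noncomm_ring
      rw [e]
      exact hVp.add (ih.conjTranspose_mul_mul_same _)
  have hc : Continuous fun M : Matrix m m ℂ => star x ⬝ᵥ ((Y - M) *ᵥ x) := by fun_prop
  have := (hc.tendsto 0).comp (hB.tendsto_conj_cayley Y)
  rw [sub_zero] at this
  exact ge_of_tendsto' this fun k => (h2 k).dotProduct_mulVec_nonneg x

/-- In Y = V + CᴴYC the term V is already positive definite, and the other one is semidefinite by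
the previous result. -/
theorem IsHurwitz.posDef_of_lyapunov (hB : IsHurwitz B) (hW : W.PosDef)
    (h : Y * B + Bᴴ * Y = -W) : Y.PosDef := by
  have hY := hB.posSemidef_of_lyapunov hW.posSemidef h
  have hu := (Matrix.isUnit_iff_isUnit_det _).1 hB.isUnit_sub_one
  rw [cayley_stein hB.isUnit_sub_one h, two_smul]
  have : ((B - 1)⁻¹ᴴ * W * (B - 1)⁻¹).PosDef := by
    refine hW.conjTranspose_mul_mul_same (Function.LeftInverse.injective (g := (B - 1).mulVec) ?_)
    intro v
    rw [mulVec_mulVec, mul_nonsing_inv _ hu, one_mulVec]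
  exact (this.add this).add_posSemidef (hY.conjTranspose_mul_mul_same _)

end Lyapunov


/-! ### Arithmetic of four-by-four and bordered block matrices -/

section Blocks4

variable {n₁ n₂ n₃ : ℕ}
    {A11 : Matrix (Fin n₁) (Fin n₁) ℂ} {A12 : Matrix (Fin n₁) (Fin n₂) ℂ} {A13 : Matrix (Fin n₁)
    (Fin n₃) ℂ} {A14 : Matrix (Fin n₁) (Fin n₁) ℂ}
    {A21 : Matrix (Fin n₂) (Fin n₁) ℂ} {A22 : Matrix (Fin n₂) (Fin n₂) ℂ} {A23 : Matrix (Fin n₂)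
    (Fin n₃) ℂ} {A24 : Matrix (Fin n₂) (Fin n₁) ℂ}
    {A31 : Matrix (Fin n₃) (Fin n₁) ℂ} {A32 : Matrix (Fin n₃) (Fin n₂) ℂ} {A33 : Matrix (Fin n₃)
    (Fin n₃) ℂ} {A34 : Matrix (Fin n₃) (Fin n₁) ℂ}
    {A41 : Matrix (Fin n₁) (Fin n₁) ℂ} {A42 : Matrix (Fin n₁) (Fin n₂) ℂ} {A43 : Matrix (Fin n₁)
    (Fin n₃) ℂ} {A44 : Matrix (Fin n₁) (Fin n₁) ℂ}
    {B11 : Matrix (Fin n₁) (Fin n₁) ℂ} {B12 : Matrix (Fin n₁) (Fin n₂) ℂ} {B13 : Matrix (Fin n₁)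
    (Fin n₃) ℂ} {B14 : Matrix (Fin n₁) (Fin n₁) ℂ}
    {B21 : Matrix (Fin n₂) (Fin n₁) ℂ} {B22 : Matrix (Fin n₂) (Fin n₂) ℂ} {B23 : Matrix (Fin n₂)
    (Fin n₃) ℂ} {B24 : Matrix (Fin n₂) (Fin n₁) ℂ}
    {B31 : Matrix (Fin n₃) (Fin n₁) ℂ} {B32 : Matrix (Fin n₃) (Fin n₂) ℂ} {B33 : Matrix (Fin n₃)
    (Fin n₃) ℂ} {B34 : Matrix (Fin n₃) (Fin n₁) ℂ}
    {B41 : Matrix (Fin n₁) (Fin n₁) ℂ} {B42 : Matrix (Fin n₁) (Fin n₂) ℂ} {B43 : Matrix (Fin n₁)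
    (Fin n₃) ℂ} {B44 : Matrix (Fin n₁) (Fin n₁) ℂ}

theorem blocks4_mul :
    blocks4
      A11 A12 A13 A14
      A21 A22 A23 A24
      A31 A32 A33 A34
      A41 A42 A43 A44 * blocks4
      B11 B12 B13 B14
      B21 B22 B23 B24
      B31 B32 B33 B34
      B41 B42 B43 B44 = blocks4
      (A11 * B11 + A12 * B21 + (A13 * B31 + A14 * B41))
      (A11 * B12 + A12 * B22 + (A13 * B32 + A14 * B42))
      (A11 * B13 + A12 * B23 + (A13 * B33 + A14 * B43))
      (A11 * B14 + A12 * B24 + (A13 * B34 + A14 * B44))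
      (A21 * B11 + A22 * B21 + (A23 * B31 + A24 * B41))
      (A21 * B12 + A22 * B22 + (A23 * B32 + A24 * B42))
      (A21 * B13 + A22 * B23 + (A23 * B33 + A24 * B43))
      (A21 * B14 + A22 * B24 + (A23 * B34 + A24 * B44))
      (A31 * B11 + A32 * B21 + (A33 * B31 + A34 * B41))
      (A31 * B12 + A32 * B22 + (A33 * B32 + A34 * B42))
      (A31 * B13 + A32 * B23 + (A33 * B33 + A34 * B43))
      (A31 * B14 + A32 * B24 + (A33 * B34 + A34 * B44))
      (A41 * B11 + A42 * B21 + (A43 * B31 + A44 * B41))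
      (A41 * B12 + A42 * B22 + (A43 * B32 + A44 * B42))
      (A41 * B13 + A42 * B23 + (A43 * B33 + A44 * B43))
      (A41 * B14 + A42 * B24 + (A43 * B34 + A44 * B44)) := by
  simp only [blocks4, fromBlocks_multiply, fromBlocks_add]

theorem blocks4_add :
    blocks4
      A11 A12 A13 A14
      A21 A22 A23 A24
      A31 A32 A33 A34
      A41 A42 A43 A44 + blocks4
      B11 B12 B13 B14
      B21 B22 B23 B24
      B31 B32 B33 B34
      B41 B42 B43 B44 = blocks4
      (A11 + B11) (A12 + B12) (A13 + B13) (A14 + B14)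
      (A21 + B21) (A22 + B22) (A23 + B23) (A24 + B24)
      (A31 + B31) (A32 + B32) (A33 + B33) (A34 + B34)
      (A41 + B41) (A42 + B42) (A43 + B43) (A44 + B44) := by
  simp only [blocks4, fromBlocks_add]

theorem blocks4_neg :
    -blocks4
      A11 A12 A13 A14
      A21 A22 A23 A24
      A31 A32 A33 A34
      A41 A42 A43 A44 = blocks4
      (-A11) (-A12) (-A13) (-A14)
      (-A21) (-A22) (-A23) (-A24)
      (-A31) (-A32) (-A33) (-A34)
      (-A41) (-A42) (-A43) (-A44) := by
  simp only [blocks4, fromBlocks_neg]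

theorem blocks4_conjTranspose :
    (blocks4
      A11 A12 A13 A14
      A21 A22 A23 A24
      A31 A32 A33 A34
      A41 A42 A43 A44)ᴴ = blocks4
      A11ᴴ A21ᴴ A31ᴴ A41ᴴ
      A12ᴴ A22ᴴ A32ᴴ A42ᴴ
      A13ᴴ A23ᴴ A33ᴴ A43ᴴ
      A14ᴴ A24ᴴ A34ᴴ A44ᴴ := by
  simp only [blocks4, fromBlocks_conjTranspose]

theorem blocks4_inj :
    blocks4
      A11 A12 A13 A14
      A21 A22 A23 A24
      A31 A32 A33 A34
      A41 A42 A43 A44 = blocks4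
      B11 B12 B13 B14
      B21 B22 B23 B24
      B31 B32 B33 B34
      B41 B42 B43 B44 ↔
      A11 = B11 ∧ A12 = B12 ∧ A13 = B13 ∧ A14 = B14 ∧
      A21 = B21 ∧ A22 = B22 ∧ A23 = B23 ∧ A24 = B24 ∧
      A31 = B31 ∧ A32 = B32 ∧ A33 = B33 ∧ A34 = B34 ∧
      A41 = B41 ∧ A42 = B42 ∧ A43 = B43 ∧ A44 = B44 := by
  simp only [blocks4, fromBlocks_inj]
  tauto

theorem exists_eq_blocks4 (M : Matrix (Idx4 n₁ n₂ n₃) (Idx4 n₁ n₂ n₃) ℂ) :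
    ∃ (Y11 : Matrix (Fin n₁) (Fin n₁) ℂ) (Y12 : Matrix (Fin n₁) (Fin n₂) ℂ) (Y13 : Matrix
    (Fin n₁) (Fin n₃) ℂ) (Y14 : Matrix (Fin n₁) (Fin n₁) ℂ),
    ∃ (Y21 : Matrix (Fin n₂) (Fin n₁) ℂ) (Y22 : Matrix (Fin n₂) (Fin n₂) ℂ) (Y23 : Matrix
    (Fin n₂) (Fin n₃) ℂ) (Y24 : Matrix (Fin n₂) (Fin n₁) ℂ),
    ∃ (Y31 : Matrix (Fin n₃) (Fin n₁) ℂ) (Y32 : Matrix (Fin n₃) (Fin n₂) ℂ) (Y33 : Matrix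
    (Fin n₃) (Fin n₃) ℂ) (Y34 : Matrix (Fin n₃) (Fin n₁) ℂ),
    ∃ (Y41 : Matrix (Fin n₁) (Fin n₁) ℂ) (Y42 : Matrix (Fin n₁) (Fin n₂) ℂ) (Y43 : Matrix
    (Fin n₁) (Fin n₃) ℂ) (Y44 : Matrix (Fin n₁) (Fin n₁) ℂ),
    M = blocks4
      Y11 Y12 Y13 Y14
      Y21 Y22 Y23 Y24
      Y31 Y32 Y33 Y34
      Y41 Y42 Y43 Y44 :=
  ⟨_, _, _, _,
    _, _, _, _,
    _, _, _, _,
    _, _, _, _, by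
    simp only [blocks4]
    rw [← fromBlocks_toBlocks M, ← fromBlocks_toBlocks M.toBlocks₁₁,
      ← fromBlocks_toBlocks M.toBlocks₁₂, ← fromBlocks_toBlocks M.toBlocks₂₁,
      ← fromBlocks_toBlocks M.toBlocks₂₂]⟩

end Blocks4

section Border

variable {n₁ n₂ n₃ n₅ : ℕ} {M N : Matrix (Idx4 n₁ n₂ n₃) (Idx4 n₁ n₂ n₃) ℂ}

theorem border_add : border n₅ M + border n₅ N = border n₅ (M + N) := by
  simp [border, fromBlocks_add]

theorem border_neg : -border n₅ M = border n₅ (-M) := by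
  simp [border, fromBlocks_neg]

theorem border_smul (z : ℂ) : z • border n₅ M = border n₅ (z • M) := by
  simp [border, fromBlocks_smul]

theorem border_conjTranspose : (border n₅ M)ᴴ = border n₅ Mᴴ := by
  simp [border, fromBlocks_conjTranspose]

end Border

/-! ### Block elimination to almost Kronecker form -/

section Reduction

variable {n₁ n₂ n₃ : ℕ}
    {E11 : Matrix (Fin n₁) (Fin n₁) ℂ} {E12 : Matrix (Fin n₁) (Fin n₂) ℂ}
    {E21 : Matrix (Fin n₂) (Fin n₁) ℂ} {E22 : Matrix (Fin n₂) (Fin n₂) ℂ}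
    {A11 : Matrix (Fin n₁) (Fin n₁) ℂ} {A12 : Matrix (Fin n₁) (Fin n₂) ℂ}
    {A13 : Matrix (Fin n₁) (Fin n₃) ℂ} {A14 : Matrix (Fin n₁) (Fin n₁) ℂ}
    {A21 : Matrix (Fin n₂) (Fin n₁) ℂ} {A22 : Matrix (Fin n₂) (Fin n₂) ℂ}
    {A23 : Matrix (Fin n₂) (Fin n₃) ℂ}
    {A31 : Matrix (Fin n₃) (Fin n₁) ℂ} {A32 : Matrix (Fin n₃) (Fin n₂) ℂ}
    {A33 : Matrix (Fin n₃) (Fin n₃) ℂ} {A41 : Matrix (Fin n₁) (Fin n₁) ℂ}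

/-- Block elimination of a regular pencil in staircase form. -/
theorem exists_blocks4_reduction (hE22 : IsUnit E22) (hA14 : IsUnit A14) (hA33 : IsUnit A33)
    (hA41 : IsUnit A41) :
    ∃ L Z : Matrix (Idx4 n₁ n₂ n₃) (Idx4 n₁ n₂ n₃) ℂ, IsUnit L ∧ IsUnit Z ∧
      L * blocks4
        E11 E12 0 0
        E21 E22 0 0
        0 0 0 0
        0 0 0 0 * Z = blocks4
        (E11 - E12 * E22⁻¹ * E21) 0 0 0
        0 E22 0 0
        0 0 0 0
        0 0 0 0 ∧
      L * blocks4
        A11 A12 A13 A14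
        A21 A22 A23 0
        A31 A32 A33 0
        A41 0 0 0 * Z = blocks4
        0 0 0 1
        0 (A22 - A23 * A33⁻¹ * A32) 0 0
        0 0 1 0
        (-1) 0 0 0 := by
  -- Names for the entries of Z and L. Block columns and rows 3, 4 of E vanish, so rows 3, 4 of Z
  -- and columns 3, 4 of L are free for eliminating in A, while s and l are forced by E₂₁ and E₁₂.
  obtain ⟨s, hs⟩ : ∃ s, s = E22⁻¹ * E21 := ⟨_, rfl⟩
  obtain ⟨l, hl⟩ : ∃ l, l = E12 * E22⁻¹ := ⟨_, rfl⟩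
  obtain ⟨u, hu⟩ : ∃ u, u = -(A33⁻¹ * (A31 - A32 * s)) := ⟨_, rfl⟩
  obtain ⟨v, hv⟩ : ∃ v, v = -(A14⁻¹ * (A11 - A12 * s + A13 * u)) := ⟨_, rfl⟩
  obtain ⟨c, hc⟩ : ∃ c, c = A21 - A22 * s + A23 * u := ⟨_, rfl⟩
  obtain ⟨f, hf⟩ : ∃ f, f = A33⁻¹ * A32 := ⟨_, rfl⟩
  obtain ⟨d, hd⟩ : ∃ d, d = A22 - A23 * f := ⟨_, rfl⟩
  -- The choice of w leaves l * d instead of 0 in position (1,2): the row operation by -l that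
  -- removes E₁₂ then cancels it.
  obtain ⟨w, hw⟩ : ∃ w, w = -(A14⁻¹ * (A12 - A13 * f - l * d)) := ⟨_, rfl⟩
  obtain ⟨y, hy⟩ : ∃ y, y = -(A14⁻¹ * A13) := ⟨_, rfl⟩
  have hE22 := (Matrix.isUnit_iff_isUnit_det _).1 hE22
  have hA14' := (Matrix.isUnit_iff_isUnit_det _).1 hA14
  have hA33' := (Matrix.isUnit_iff_isUnit_det _).1 hA33
  have hA41' := (Matrix.isUnit_iff_isUnit_det _).1 hA41
  have hEZ : blocks4
        E11 E12 0 0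
        E21 E22 0 0
        0 0 (0 : Matrix (Fin n₃) (Fin n₃) ℂ) 0
        0 0 0 0 * blocks4
        1 0 0 0
        (-s) 1 0 0
        u (-f) 1 0
        v w y A14⁻¹ = blocks4
        (E11 - E12 * s) E12 0 0
        0 E22 0 0
        0 0 0 0
        0 0 0 0 := by
    rw [blocks4_mul, blocks4_inj]
    simp [sub_eq_add_neg, hs, mul_nonsing_inv_cancel_left _ _ hE22]
  have hAZ : blocks4
        A11 A12 A13 A14
        A21 A22 A23 0
        A31 A32 A33 0
        A41 0 0 0 * blocks4
        1 0 0 0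
        (-s) 1 0 0
        u (-f) 1 0
        v w y A14⁻¹ = blocks4
        0 (l * d) 0 1
        c d A23 0
        0 0 A33 0
        A41 0 0 0 := by
    rw [blocks4_mul, blocks4_inj]
    simp only [Matrix.mul_zero, Matrix.mul_one, Matrix.mul_neg, Matrix.zero_mul, add_zero,
      zero_add, mul_nonsing_inv _ hA14', and_true, true_and, neg_zero, Matrix.mul_one]
    refine ⟨?_, ?_, ?_, ?_, ?_, ?_, ?_⟩
    · rw [hv, Matrix.mul_neg, mul_nonsing_inv_cancel_left _ _ hA14']; abel
    · rw [hw, Matrix.mul_neg, mul_nonsing_inv_cancel_left _ _ hA14']; abel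
    · rw [hy, Matrix.mul_neg, mul_nonsing_inv_cancel_left _ _ hA14']; abel
    · rw [hc]; abel
    · rw [hd]; abel
    · rw [hu, Matrix.mul_neg, mul_nonsing_inv_cancel_left _ _ hA33']; abel
    · rw [hf, mul_nonsing_inv_cancel_left _ _ hA33']; abel
  refine ⟨blocks4
        1 (-l) (l * A23 * A33⁻¹) (l * c * A41⁻¹)
        0 1 (-(A23 * A33⁻¹)) (-(c * A41⁻¹))
        0 0 A33⁻¹ 0
        0 0 0 (-A41⁻¹), blocks4
        1 0 0 0
        (-s) 1 0 0
        u (-f) 1 0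
        v w y A14⁻¹, ?_, ?_, ?_, ?_⟩
  · have h0 : fromBlocks 0 0 0 0 = (0 : Matrix (Fin n₃ ⊕ Fin n₁) (Fin n₁ ⊕ Fin n₂) ℂ) :=
      fromBlocks_zero
    rw [Matrix.isUnit_iff_isUnit_det, blocks4, h0, det_fromBlocks_zero₂₁, det_fromBlocks_zero₂₁,
      det_fromBlocks_zero₂₁]
    simpa [det_neg, det_nonsing_inv] using ⟨hA33'.ne_zero, hA41'.ne_zero⟩
  · have h0 : fromBlocks 0 0 0 0 = (0 : Matrix (Fin n₁ ⊕ Fin n₂) (Fin n₃ ⊕ Fin n₁) ℂ) :=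
      fromBlocks_zero
    rw [Matrix.isUnit_iff_isUnit_det, blocks4, h0, det_fromBlocks_zero₁₂, det_fromBlocks_zero₁₂,
      det_fromBlocks_zero₁₂]
    simpa [det_nonsing_inv] using hA14'.ne_zero
  · rw [Matrix.mul_assoc, hEZ, blocks4_mul, blocks4_inj]
    simp [hl, hs, nonsing_inv_mul_cancel_right _ _ hE22, Matrix.mul_assoc]
  · rw [Matrix.mul_assoc, hAZ, blocks4_mul, blocks4_inj]
    simp [nonsing_inv_mul_cancel_right _ _ hA33', nonsing_inv_mul_cancel_right _ _ hA41',
      nonsing_inv_mul _ hA33', nonsing_inv_mul _ hA41', hd, hf, Matrix.mul_assoc]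

/-- The Schur complement of a positive definite block matrix is positive definite. -/
theorem posDef_schur (h : (fromBlocks E11 E21ᴴ E21 E22).PosDef) (hE22 : IsUnit E22) :
    (E11 - E21ᴴ * E22⁻¹ * E21).PosDef := by
  have hE22' := (Matrix.isUnit_iff_isUnit_det _).1 hE22
  -- The second block row of the matrix annihilates this column, so the congruence leaves exactly
  -- the Schur complement.
  have h1 := h.conjTranspose_mul_mul_same (B := fromRows 1 (-(E22⁻¹ * E21))) (by
    refine Function.LeftInverse.injective (g := fun v => v ∘ Sum.inl) fun v => ?_
    simp [fromRows_mulVec])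
  convert h1 using 1
  rw [conjTranspose_fromRows_eq_fromCols_conjTranspose, Matrix.mul_assoc (fromCols _ _),
    fromBlocks_mul_fromRows, fromCols_mul_fromRows]
  simp [mul_nonsing_inv_cancel_left _ _ hE22', Matrix.mul_assoc, sub_eq_add_neg]

end Reduction

theorem skewPart_sub_neg_hermPart {n : ℕ} (A : Matrix (Fin n) (Fin n) ℂ) :
    skewPart A - -hermPart A = A := by
  ext i j
  simp [skewPart, hermPart]
  ring

/-! ### Almost Kronecker forms of staircase forms -/

namespace StaircaseForm

variable {n : ℕ} {E J R : Matrix (Fin n) (Fin n) ℂ}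

theorem A_eq (S : StaircaseForm E J R) : S.P * (J - R) * S.Pᴴ = border S.n₅ (blocks4
    (S.J11 - S.R11) (-S.J21ᴴ - S.R21ᴴ) (-S.J31ᴴ - S.R31ᴴ) (-S.J41ᴴ)
    (S.J21 - S.R21) (S.J22 - S.R22) (-S.J32ᴴ - S.R32ᴴ) 0
    (S.J31 - S.R31) (S.J32 - S.R32) (S.J33 - S.R33) 0
    S.J41 0 0 0) := by
  rw [Matrix.mul_sub, Matrix.sub_mul, S.J_eq, S.R_eq, sub_eq_add_neg, border_neg, border_add,
    blocks4_neg, blocks4_add]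
  simp [sub_eq_add_neg]

/-- Every staircase form admits an almost Kronecker form whose dynamic part is
`E₂₂ y' = A22Schur y`. -/
theorem exists_almostKroneckerForm (S : StaircaseForm E J R) :
    ∃ K : AlmostKroneckerForm S, K.E22 = S.E22 ∧ K.A22 = S.A22Schur := by
  obtain ⟨L, Z, hL, hZ, h1, h2⟩ := exists_blocks4_reduction (E11 := S.E11) (E12 := S.E21ᴴ)
    (E21 := S.E21) (A11 := S.J11 - S.R11) (A12 := -S.J21ᴴ - S.R21ᴴ) (A13 := -S.J31ᴴ - S.R31ᴴ)
    (A21 := S.J21 - S.R21) (A22 := S.J22 - S.R22) (A23 := -S.J32ᴴ - S.R32ᴴ)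
    (A31 := S.J31 - S.R31) (A32 := S.J32 - S.R32) S.E22_posDef.isUnit
    ((isUnit_conjTranspose S.J41).2 S.J41_isUnit).neg S.A33_isUnit S.J41_isUnit
  have hu : ∀ M : Matrix (Idx4 S.n₁ S.n₂ S.n₃) (Idx4 S.n₁ S.n₂ S.n₃) ℂ, IsUnit M →
      IsUnit (fromBlocks M 0 0 (1 : Matrix (Fin S.n₅) (Fin S.n₅) ℂ)) := by
    intro M hM
    rw [Matrix.isUnit_iff_isUnit_det] at hM ⊢
    simpa [det_fromBlocks_zero₁₂] using hM
  have hb : ∀ M : Matrix (Idx4 S.n₁ S.n₂ S.n₃) (Idx4 S.n₁ S.n₂ S.n₃) ℂ,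
      fromBlocks L 0 0 (1 : Matrix (Fin S.n₅) (Fin S.n₅) ℂ) * border S.n₅ M *
        fromBlocks Z 0 0 (1 : Matrix (Fin S.n₅) (Fin S.n₅) ℂ) = border S.n₅ (L * M * Z) := by
    intro M
    simp [border, fromBlocks_multiply]
  exact ⟨{
    L := fromBlocks L 0 0 1
    Z := fromBlocks Z 0 0 1
    L_isUnit := hu L hL
    Z_isUnit := hu Z hZ
    E11 := S.E11 - S.E21ᴴ * S.E22⁻¹ * S.E21
    E22 := S.E22
    A22 := S.A22Schur
    E11_posDef := posDef_schur S.E_posDef S.E22_posDef.isUnit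
    E22_posDef := S.E22_posDef
    E_eq := by rw [S.E_eq, hb, h1]
    A_eq := by rw [S.A_eq, hb, h2]; rfl }, rfl, rfl⟩

/-- A unit vector in the fifth block pulls back to a common kernel vector of E and A, which makes zE
- A singular for every z. -/
theorem n₅_eq_zero {A : Matrix (Fin n) (Fin n) ℂ} (hreg : RegularPencil E A)
    (S : PencilStaircaseForm E A) : S.n₅ = 0 := by
  by_contra h
  obtain ⟨z, hz⟩ := hreg
  apply hz
  have hE := S.E_eq
  have hA := S.A_eq
  rw [skewPart_sub_neg_hermPart] at hA
  have hp : z • E - A = S.Pᴴ * (S.P * (z • E - A) * S.Pᴴ) * S.P := by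
    simp only [Matrix.mul_assoc, S.conjTranspose_mul, Matrix.mul_one]
    rw [← Matrix.mul_assoc, S.conjTranspose_mul, Matrix.one_mul]
  let i : Fin S.n₅ := ⟨0, Nat.pos_of_ne_zero h⟩
  refine Matrix.exists_mulVec_eq_zero_iff.1
    ⟨S.Pᴴ *ᵥ Pi.single (Sum.inr i) 1, fun h0 => ?_, ?_⟩
  · have := congrArg (S.P *ᵥ ·) h0
    simp only [mulVec_mulVec, S.mul_conjTranspose, one_mulVec, mulVec_zero] at this
    simpa using congrFun this (Sum.inr i)
  · rw [hp, mulVec_mulVec, Matrix.mul_assoc, S.mul_conjTranspose, Matrix.mul_one,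
      Matrix.mul_sub, Matrix.sub_mul, Matrix.mul_smul, Matrix.smul_mul, hE, hA, border_smul,
      sub_eq_add_neg, border_neg, border_add, ← mulVec_mulVec, mulVec_single_one]
    have : (border S.n₅ (z • blocks4 S.E11 S.E21ᴴ 0 0 S.E21 S.E22 0 0 0 0 0 0 0 0 0 0 +
        -blocks4 (S.J11 - S.R11) (-S.J21ᴴ - S.R21ᴴ) (-S.J31ᴴ - S.R31ᴴ) (-S.J41ᴴ)
          (S.J21 - S.R21) (S.J22 - S.R22) (-S.J32ᴴ - S.R32ᴴ) 0
          (S.J31 - S.R31) (S.J32 - S.R32) (S.J33 - S.R33) 0 S.J41 0 0 0)).col (Sum.inr i) = 0 := by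
      ext j
      rcases j with j | j <;> simp [border, fromBlocks]
    rw [this, mulVec_zero]

end StaircaseForm

/-- All finite eigenvalues of the pencil `λ E - A` lie in the open left half-plane, and the pencil
is regular. -/
def PencilStable {n : ℕ} (E A : Matrix (Fin n) (Fin n) ℂ) : Prop :=
  ∀ (z : ℂ) (v : Fin n → ℂ), v ≠ 0 → A *ᵥ v = z • (E *ᵥ v) → z.re < 0

namespace AlmostKroneckerForm

variable {n : ℕ} {E A : Matrix (Fin n) (Fin n) ℂ} {S : PencilStaircaseForm E A}

/-- If the fifth block is absent, an almost Kronecker form is a strict equivalence of pencils. -/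
theorem exists_equivalence (K : AlmostKroneckerForm S) (h5 : S.n₅ = 0) :
    ∃ (G : Matrix (Idx4 S.n₁ S.n₂ S.n₃) (Fin n) ℂ) (G' : Matrix (Fin n) (Idx4 S.n₁ S.n₂ S.n₃) ℂ)
      (H : Matrix (Fin n) (Idx4 S.n₁ S.n₂ S.n₃) ℂ) (H' : Matrix (Idx4 S.n₁ S.n₂ S.n₃) (Fin n) ℂ),
      G * G' = 1 ∧ G' * G = 1 ∧ H * H' = 1 ∧ H' * H = 1 ∧
      G * E * H = blocks4
        K.E11 0 0 0
        0 K.E22 0 0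
        0 0 0 0
        0 0 0 0 ∧
      G * A * H = blocks4
        0 0 0 1
        0 K.A22 0 0
        0 0 1 0
        (-1) 0 0 0 ∧
      (∀ Y, K.back Y = Gᴴ * Y * G) ∧
      ∀ W, (K.What W).toBlocks₁₁ = Hᴴ * (Eᴴ * W * E) * H := by
  -- With an empty fifth block `Sum.inl` is a bijection of index sets, so restricting to it
  -- preserves products and inverses.
  have : IsEmpty (Fin S.n₅) := by rw [h5]; infer_instance
  have hb : Function.Bijective (Sum.inl : Idx4 S.n₁ S.n₂ S.n₃ → Idx5 S.n₁ S.n₂ S.n₃ S.n₅) :=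
    ⟨Sum.inl_injective, fun x => by rcases x with x | x; exacts [⟨x, rfl⟩, isEmptyElim x]⟩
  have hL := (Matrix.isUnit_iff_isUnit_det _).1 K.L_isUnit
  have hZ := (Matrix.isUnit_iff_isUnit_det _).1 K.Z_isUnit
  have hE := K.E_eq
  have hA := K.A_eq
  rw [skewPart_sub_neg_hermPart] at hA
  have hq : ∀ M : Matrix (Fin n) (Fin n) ℂ, (K.L * S.P).submatrix Sum.inl id * M *
      (S.Pᴴ * K.Z).submatrix id Sum.inl =
      (K.L * (S.P * M * S.Pᴴ) * K.Z).submatrix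
        (Sum.inl : Idx4 S.n₁ S.n₂ S.n₃ → _) (Sum.inl : Idx4 S.n₁ S.n₂ S.n₃ → _) := by
    intro M
    rw [← submatrix_id_id M, ← submatrix_mul _ _ _ _ _ Function.bijective_id,
      ← submatrix_mul _ _ _ _ _ Function.bijective_id, submatrix_id_id]
    simp only [Matrix.mul_assoc]
  refine ⟨(K.L * S.P).submatrix Sum.inl id, (S.Pᴴ * K.L⁻¹).submatrix id Sum.inl,
    (S.Pᴴ * K.Z).submatrix id Sum.inl, (K.Z⁻¹ * S.P).submatrix Sum.inl id, ?_, ?_, ?_, ?_, ?_, ?_,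
    ?_, ?_⟩
  · rw [← submatrix_mul _ _ _ _ _ Function.bijective_id, Matrix.mul_assoc, ← Matrix.mul_assoc S.P,
      S.mul_conjTranspose, Matrix.one_mul, mul_nonsing_inv _ hL, submatrix_one _ Sum.inl_injective]
  · rw [← submatrix_mul _ _ _ _ _ hb, Matrix.mul_assoc, nonsing_inv_mul_cancel_left _ _ hL,
      S.conjTranspose_mul, submatrix_id_id]
  · rw [← submatrix_mul _ _ _ _ _ hb, Matrix.mul_assoc, mul_nonsing_inv_cancel_left _ _ hZ,
      S.conjTranspose_mul, submatrix_id_id]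
  · rw [← submatrix_mul _ _ _ _ _ Function.bijective_id, Matrix.mul_assoc, ← Matrix.mul_assoc S.P,
      S.mul_conjTranspose, Matrix.one_mul, nonsing_inv_mul _ hZ, submatrix_one _ Sum.inl_injective]
  · rw [hq, hE]; rfl
  · rw [hq, hA]; rfl
  · intro Y
    conv_rhs => rw [show Y = (border S.n₅ Y).submatrix Sum.inl Sum.inl from rfl]
    rw [conjTranspose_submatrix, ← submatrix_mul _ _ _ _ _ hb, ← submatrix_mul _ _ _ _ _ hb,
      submatrix_id_id, conjTranspose_mul, back]
    simp only [Matrix.mul_assoc]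
  · intro W
    conv_rhs => rw [← submatrix_id_id (Eᴴ * W * E)]
    rw [conjTranspose_submatrix, ← submatrix_mul _ _ _ _ _ Function.bijective_id,
      ← submatrix_mul _ _ _ _ _ Function.bijective_id, conjTranspose_mul,
      conjTranspose_conjTranspose, What]
    simp only [Matrix.mul_assoc]
    rfl

/-- The finite eigenvalues of the pencil are the eigenvalues of its dynamic part. -/
theorem pencilStable_iff (K : AlmostKroneckerForm S) (h5 : S.n₅ = 0) :
    PencilStable E A ↔ IsHurwitz (K.E22⁻¹ * K.A22) := by
  obtain ⟨G, G', H, H', hGG, hGG', hHH, hHH', hE, hA, -, -⟩ := K.exists_equivalence h5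
  have hE22 := (Matrix.isUnit_iff_isUnit_det _).1 K.E22_posDef.isUnit
  have hdyn : ∀ (z : ℂ) v, K.A22 *ᵥ v = z • (K.E22 *ᵥ v) ↔ (K.E22⁻¹ * K.A22) *ᵥ v = z • v := by
    intro z v
    constructor
    · intro h
      rw [← mulVec_mulVec, h, mulVec_smul, mulVec_mulVec, nonsing_inv_mul _ hE22, one_mulVec]
    · intro h
      rw [← mulVec_smul, ← h, mulVec_mulVec, mul_nonsing_inv_cancel_left _ _ hE22]
  have hpen : ∀ (z : ℂ) v, A *ᵥ (H *ᵥ v) = z • (E *ᵥ (H *ᵥ v)) ↔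
      (G * A * H) *ᵥ v = z • ((G * E * H) *ᵥ v) := by
    intro z v
    simp only [← mulVec_mulVec, ← mulVec_smul]
    refine ⟨fun h => by rw [h], fun h => ?_⟩
    have := congrArg (G' *ᵥ ·) h
    simpa only [mulVec_mulVec, ← Matrix.mul_assoc, hGG', Matrix.one_mul] using this
  constructor
  · intro h z w hw hz
    rw [← hdyn] at hz
    set v : Idx4 S.n₁ S.n₂ S.n₃ → ℂ := Sum.elim (Sum.elim 0 w) 0 with hv
    refine h z (H *ᵥ v) (fun h0 => hw ?_) ((hpen z v).2 ?_)
    · have := congrArg (H' *ᵥ ·) h0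
      simp only [mulVec_mulVec, hHH', one_mulVec, mulVec_zero] at this
      ext i
      exact congrFun this (Sum.inl (Sum.inr i))
    · rw [hE, hA, hv]
      ext ((i | i) | (i | i)) <;> simp [blocks4, fromBlocks_mulVec, hz]
  · intro h z x hx hz
    obtain ⟨v, rfl⟩ : ∃ v, x = H *ᵥ v := ⟨H' *ᵥ x, by rw [mulVec_mulVec, hHH, one_mulVec]⟩
    rw [hpen, hE, hA] at hz
    have hv : v ≠ 0 := by rintro rfl; simp at hx
    -- Block row four gives v₁ = 0 and row three gives v₃ = 0. Row one reads v₄ = z E₁₁ v₁, so it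
    -- must come after row four. Only the dynamic component survives.
    have h4 : ∀ i, v (.inl (.inl i)) = 0 := fun i => by
      simpa [blocks4, fromBlocks_mulVec, neg_mulVec] using congrFun hz (.inr (.inr i))
    have h3 : ∀ i, v (.inr (.inl i)) = 0 := fun i => by
      simpa [blocks4, fromBlocks_mulVec] using congrFun hz (.inr (.inl i))
    have h1 : ∀ i, v (.inr (.inr i)) = 0 := fun i => by
      have h0 : (v ∘ Sum.inl) ∘ Sum.inl = 0 := funext h4
      simpa [blocks4, fromBlocks_mulVec, h0] using congrFun hz (.inl (.inl i))
    refine h z (fun i => v (.inl (.inr i))) (fun h0 => hv ?_) ((hdyn _ _).1 ?_)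
    · ext ((i | i) | (i | i))
      exacts [h4 i, congrFun h0 i, h3 i, h1 i]
    · ext i
      simpa [blocks4, fromBlocks_mulVec, Function.comp_def] using congrFun hz (.inl (.inr i))

end AlmostKroneckerForm

/-! ### Finite hypocoercivity index implies stability -/

section SemiDissipative

variable {n m : ℕ} {A : Matrix (Fin n) (Fin n) ℂ}

theorem SemiDissipative.conj (hA : SemiDissipative A) (V : Matrix (Fin n) (Fin m) ℂ) :
    SemiDissipative (Vᴴ * A * V) := by
  have := hA.conjTranspose_mul_mul_same V
  rw [SemiDissipative]
  convert this using 1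
  simp only [hermPart, conjTranspose_mul, conjTranspose_conjTranspose, Matrix.mul_neg,
    Matrix.neg_mul, Matrix.mul_smul, Matrix.smul_mul, Matrix.mul_add, Matrix.add_mul,
    Matrix.mul_assoc]

/-- An eigenvector v with Re z ≥ 0 lies in ker R because R ≥ 0, and is then an eigenvector of Jᴴ.
The quadratic form of every sum in the definition of the index vanishes at v. -/
theorem SemiDissipative.isHurwitz_of_matrixHCIndex (hA : SemiDissipative A)
    (h : matrixHCIndex A ≠ ⊤) : IsHurwitz A := by
  intro z v hv hz
  by_contra! hre
  obtain ⟨k, hk⟩ : ∃ k : ℕ, (∑ j ∈ Finset.range (k + 1),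
      skewPart A ^ j * (-hermPart A) * (skewPart A)ᴴ ^ j).PosDef := by
    by_contra! h'
    apply h
    simp only [matrixHCIndex, iInf_eq_top]
    exact fun k hk => absurd hk (h' k)
  have hq : star v ⬝ᵥ (-hermPart A *ᵥ v) = -(z.re : ℂ) * (star v ⬝ᵥ v) := by
    have h1 : star v ⬝ᵥ (Aᴴ *ᵥ v) = star z * (star v ⬝ᵥ v) := by
      rw [dotProduct_mulVec, ← star_mulVec, hz, star_smul, smul_dotProduct, smul_eq_mul]
    rw [hermPart, neg_mulVec, smul_mulVec, add_mulVec, dotProduct_neg, dotProduct_smul,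
      dotProduct_add, h1, hz, dotProduct_smul, smul_eq_mul, smul_eq_mul, Complex.re_eq_add_conj,
      starRingEnd_apply]
    ring
  have hR : -hermPart A *ᵥ v = 0 := by
    rw [← hA.dotProduct_mulVec_zero_iff v]
    refine le_antisymm ?_ (hA.dotProduct_mulVec_nonneg v)
    rw [hq, neg_mul, neg_nonpos]
    exact mul_nonneg (by exact_mod_cast hre) (dotProduct_star_self_nonneg v)
  have hJ : (skewPart A)ᴴ *ᵥ v = (-z) • v := by
    have h1 : (skewPart A)ᴴ = -skewPart A := by
      ext i j
      simp [skewPart]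
      ring
    have h2 : skewPart A *ᵥ v = z • v := by
      rw [← hz]
      conv_rhs => rw [← skewPart_sub_neg_hermPart A, sub_mulVec, hR, sub_zero]
    rw [h1, neg_mulVec, h2, neg_smul]
  have hJk : ∀ j : ℕ, (skewPart A)ᴴ ^ j *ᵥ v = (-z) ^ j • v := by
    intro j
    induction j with
    | zero => simp
    | succ j ih => rw [pow_succ, ← mulVec_mulVec, hJ, mulVec_smul, ih, smul_smul, pow_succ']
  have := hk.dotProduct_mulVec_pos hv
  rw [sum_mulVec, Finset.sum_eq_zero, dotProduct_zero] at this
  · exact lt_irrefl _ this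
  · intro j _
    rw [← mulVec_mulVec, hJk, ← mulVec_mulVec, mulVec_smul, hR, smul_zero, mulVec_zero]

end SemiDissipative

theorem IsHurwitz.of_mul_eq_mul {m : Type*} [Fintype m] [DecidableEq m] {B C s : Matrix m m ℂ}
    (hB : IsHurwitz B) (hs : IsUnit s) (h : s * C = B * s) : IsHurwitz C := by
  intro z v hv hz
  refine hB z (s *ᵥ v) (fun h0 => hv ?_) ?_
  · exact mulVec_injective_of_isUnit hs (h0.trans (mulVec_zero s).symm)
  · rw [mulVec_mulVec, ← h, ← mulVec_mulVec, hz, mulVec_smul]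

theorem fromRows_add_fromRows {p q r : Type*} (X Y : Matrix p r ℂ) (X' Y' : Matrix q r ℂ) :
    fromRows X X' + fromRows Y Y' = fromRows (X + Y) (X' + Y') := by
  ext (i | i) j <;> simp

namespace StaircaseForm

variable {n : ℕ} {E A : Matrix (Fin n) (Fin n) ℂ}

/-- Although the eliminated block is not Hermitian, the Schur complement is a compression of A, and
so inherits semi-dissipativity. -/
theorem exists_A22Schur_eq (S : PencilStaircaseForm E A) :
    ∃ V : Matrix (Fin n) (Fin S.n₂) ℂ, S.A22Schur = Vᴴ * A * V := by
  have hA := S.A_eq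
  rw [skewPart_sub_neg_hermPart] at hA
  have h33 := (Matrix.isUnit_iff_isUnit_det _).1 S.A33_isUnit
  -- The third component makes block row three of ǍV vanish, so the adjoint of that component on the
  -- left contributes nothing.
  obtain ⟨V, hV⟩ : ∃ V : Matrix (Idx5 S.n₁ S.n₂ S.n₃ S.n₅) (Fin S.n₂) ℂ,
      V = fromRows (fromRows (fromRows 0 1)
        (fromRows (-((S.J33 - S.R33)⁻¹ * (S.J32 - S.R32))) 0)) 0 := ⟨_, rfl⟩
  refine ⟨S.Pᴴ * V, ?_⟩
  have : (S.Pᴴ * V)ᴴ * A * (S.Pᴴ * V) = Vᴴ * (S.P * A * S.Pᴴ * V) := by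
    rw [Matrix.conjTranspose_mul, conjTranspose_conjTranspose]
    simp only [Matrix.mul_assoc]
  rw [this, hA, hV]
  simp only [border, blocks4, fromBlocks_mul_fromRows, fromRows_add_fromRows,
    conjTranspose_fromRows_eq_fromCols_conjTranspose, fromCols_mul_fromRows]
  simp only [Matrix.mul_neg, mul_nonsing_inv_cancel_left _ _ h33]
  simp [A22Schur, sub_eq_add_neg, Matrix.mul_assoc, fromCols_mul_fromRows]

/-- A staircase form with finite hypocoercivity index has asymptotically stable dynamics. -/
theorem isHurwitz_of_hcIndex (S : PencilStaircaseForm E A) (hA : SemiDissipative A)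
    (h : S.hcIndex ≠ ⊤) : IsHurwitz (S.E22⁻¹ * S.A22Schur) := by
  obtain ⟨V, hV⟩ := S.exists_A22Schur_eq
  have hs : CFC.sqrt S.E22 * CFC.sqrt S.E22 = S.E22 :=
    CFC.sqrt_mul_sqrt_self S.E22 S.E22_posDef.posSemidef.nonneg
  have hsu : IsUnit (CFC.sqrt S.E22) := by
    have := S.E22_posDef.isUnit
    rw [← hs, Matrix.isUnit_iff_isUnit_det, det_mul] at this
    rw [Matrix.isUnit_iff_isUnit_det]
    exact isUnit_of_mul_isUnit_left this
  have hsh : (CFC.sqrt S.E22)⁻¹ᴴ = (CFC.sqrt S.E22)⁻¹ :=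
    (Matrix.nonneg_iff_posSemidef.1 (CFC.sqrt_nonneg S.E22)).isHermitian.inv
  have hsd : SemiDissipative ((CFC.sqrt S.E22)⁻¹ * S.A22Schur * (CFC.sqrt S.E22)⁻¹) := by
    have := (hV ▸ hA.conj V : SemiDissipative S.A22Schur).conj (CFC.sqrt S.E22)⁻¹
    rwa [hsh] at this
  -- Conjugation by E₂₂^{1/2} carries E₂₂⁻¹Â₂₂ to E₂₂^{-1/2}Â₂₂E₂₂^{-1/2}.
  refine (hsd.isHurwitz_of_matrixHCIndex h).of_mul_eq_mul hsu ?_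
  have hd := (Matrix.isUnit_iff_isUnit_det _).1 hsu
  have hinv : S.E22⁻¹ = (CFC.sqrt S.E22)⁻¹ * (CFC.sqrt S.E22)⁻¹ := by
    rw [← Matrix.mul_inv_rev, hs]
  rw [hinv]
  rw [Matrix.mul_assoc _ (CFC.sqrt S.E22)⁻¹ (CFC.sqrt S.E22), nonsing_inv_mul _ hd,
    Matrix.mul_one, Matrix.mul_assoc, mul_nonsing_inv_cancel_left _ _ hd]

end StaircaseForm

/-- A finite infimum provides one staircase form of finite index. Stability of the pencil follows
from that form alone, so independence of the index from the form need not be shown. -/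
theorem pencilStable_of_hcIndex {n : ℕ} {E A : Matrix (Fin n) (Fin n) ℂ}
    (hA : SemiDissipative A) (hreg : RegularPencil E A) (h : hcIndex E A ≠ ⊤) :
    PencilStable E A := by
  obtain ⟨S, hS⟩ : ∃ S : PencilStaircaseForm E A, S.hcIndex ≠ ⊤ := by
    by_contra! h'
    exact h (by simp [hcIndex, h'])
  obtain ⟨K, hE22, hA22⟩ := S.exists_almostKroneckerForm
  rw [K.pencilStable_iff (S.n₅_eq_zero hreg), hE22, hA22]
  exact S.isHurwitz_of_hcIndex hA hS

/-- This lets the equation for a Hermitian Y₁₄ be read as a Lyapunov equation with coefficient -Ê₁₁.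
-/
theorem isHurwitz_neg_of_posDef {m : Type*} [Fintype m] [DecidableEq m] {M : Matrix m m ℂ}
    (hM : M.PosDef) : IsHurwitz (-M) := by
  intro z v hv hz
  have h1 := hM.dotProduct_mulVec_pos hv
  have h2 : M *ᵥ v = (-z) • v := by rw [neg_smul, ← hz, neg_mulVec, neg_neg]
  rw [h2, dotProduct_smul, smul_eq_mul] at h1
  have h3 : 0 < star v ⬝ᵥ v := dotProduct_star_self_pos_iff.2 hv
  rw [Complex.pos_iff] at h1 h3
  rw [Complex.mul_re, ← h3.2, mul_zero, sub_zero] at h1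
  have := pos_of_mul_pos_left h1.1 h3.1.le
  simpa using this

/-! ### The generalized Lyapunov equation in almost Kronecker coordinates -/

namespace AlmostKroneckerForm

variable {n : ℕ} {E A W : Matrix (Fin n) (Fin n) ℂ} {S : PencilStaircaseForm E A}

theorem exists_back_eq (K : AlmostKroneckerForm S) (h5 : S.n₅ = 0) (X : Matrix (Fin n) (Fin n) ℂ) :
    ∃ Y, X = K.back Y := by
  obtain ⟨G, G', H, H', hGG, hGG', hHH, hHH', hE, hA, hY, hW⟩ := K.exists_equivalence h5
  refine ⟨G'ᴴ * X * G', ?_⟩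
  have h1 : Gᴴ * G'ᴴ = 1 := by rw [← conjTranspose_mul, hGG', conjTranspose_one]
  calc X = (Gᴴ * G'ᴴ) * X * (G' * G) := by rw [h1, hGG', Matrix.one_mul, Matrix.mul_one]
    _ = K.back (G'ᴴ * X * G') := by rw [hY]; simp only [Matrix.mul_assoc]

theorem back_injective (K : AlmostKroneckerForm S) (h5 : S.n₅ = 0) :
    Function.Injective K.back := by
  obtain ⟨G, G', H, H', hGG, hGG', hHH, hHH', hE, hA, hY, hW⟩ := K.exists_equivalence h5
  refine Function.LeftInverse.injective (g := fun X => G'ᴴ * X * G') fun Y => ?_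
  have h1 : G'ᴴ * Gᴴ = 1 := by rw [← conjTranspose_mul, hGG, conjTranspose_one]
  calc G'ᴴ * K.back Y * G' = (G'ᴴ * Gᴴ) * Y * (G * G') := by
        rw [hY]; simp only [Matrix.mul_assoc]
    _ = Y := by rw [h1, hGG, Matrix.one_mul, Matrix.mul_one]

theorem back_conjTranspose (K : AlmostKroneckerForm S)
    (Y : Matrix (Idx4 S.n₁ S.n₂ S.n₃) (Idx4 S.n₁ S.n₂ S.n₃) ℂ) :
    (K.back Y)ᴴ = K.back Yᴴ := by
  simp only [back, conjTranspose_mul, conjTranspose_conjTranspose, border_conjTranspose,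
    Matrix.mul_assoc]

theorem back_isHermitian_iff (K : AlmostKroneckerForm S) (h5 : S.n₅ = 0)
    {Y : Matrix (Idx4 S.n₁ S.n₂ S.n₃) (Idx4 S.n₁ S.n₂ S.n₃) ℂ} :
    (K.back Y).IsHermitian ↔ Yᴴ = Y := by
  rw [IsHermitian, back_conjTranspose, (K.back_injective h5).eq_iff]

/-- The transformed right-hand side factors through `diag(E₁₁, E₂₂, 0, 0)`. -/
theorem exists_What_eq (K : AlmostKroneckerForm S) (h5 : S.n₅ = 0)
    (W : Matrix (Fin n) (Fin n) ℂ) :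
    ∃ w : Matrix (Idx4 S.n₁ S.n₂ S.n₃) (Idx4 S.n₁ S.n₂ S.n₃) ℂ,
      (K.What W).toBlocks₁₁ = blocks4
        (K.E11 * w.toBlocks₁₁.toBlocks₁₁ * K.E11) (K.E11 * w.toBlocks₁₁.toBlocks₁₂ * K.E22) 0 0
        (K.E22 * w.toBlocks₁₁.toBlocks₂₁ * K.E11) (K.E22 * w.toBlocks₁₁.toBlocks₂₂ * K.E22) 0 0
        0 0 0 0
        0 0 0 0 ∧
      (W.PosSemidef → w.PosSemidef) ∧ (W.PosDef → w.PosDef) := by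
  obtain ⟨G, G', H, H', hGG, hGG', hHH, hHH', hE, hA, hY, hW⟩ := K.exists_equivalence h5
  -- Writing E as G'(GEH)H' moves W to a congruent matrix w, placed between two copies of the block
  -- diagonal GEH.
  refine ⟨G'ᴴ * W * G', ?_, fun h => h.conjTranspose_mul_mul_same _,
    fun h => h.conjTranspose_mul_mul_same (Function.LeftInverse.injective (g := (G *ᵥ ·))
      fun v => by simp only [mulVec_mulVec, hGG, one_mulVec])⟩
  have h1 : Gᴴ * G'ᴴ = 1 := by rw [← conjTranspose_mul, hGG', conjTranspose_one]
  have h2 : (K.What W).toBlocks₁₁ = (G * E * H)ᴴ * (G'ᴴ * W * G') * (G * E * H) := by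
    calc (K.What W).toBlocks₁₁ = Hᴴ * (Eᴴ * ((Gᴴ * G'ᴴ) * W * (G' * G)) * E) * H := by
          rw [hW, h1, hGG', Matrix.one_mul, Matrix.mul_one]
      _ = _ := by simp only [conjTranspose_mul, Matrix.mul_assoc]
  rw [h2, hE]
  generalize G'ᴴ * W * G' = w
  obtain ⟨w11, w12, w13, w14, w21, w22, w23, w24, w31, w32, w33, w34, w41, w42, w43, w44, rfl⟩ :=
    exists_eq_blocks4 w
  rw [blocks4_conjTranspose, blocks4_mul, blocks4_mul, blocks4_inj]
  simp [K.E11_posDef.isHermitian.eq, K.E22_posDef.isHermitian.eq, blocks4]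

theorem What_toBlocks₁₁ (K : AlmostKroneckerForm S) (h5 : S.n₅ = 0) :
    (K.What W).toBlocks₁₁ = blocks4
        (K.W11 W) (K.W12 W) 0 0
        (K.W21 W) (K.W22 W) 0 0
        0 0 0 0
        0 0 0 0 := by
  obtain ⟨w, hw, -, -⟩ := K.exists_What_eq h5 W
  simp [W11, W12, W21, W22, hw, blocks4]

theorem W11_posSemidef (K : AlmostKroneckerForm S) (h5 : S.n₅ = 0) (hW : W.PosSemidef) :
    (K.W11 W).PosSemidef := by
  obtain ⟨w, hw, h1, -⟩ := K.exists_What_eq h5 W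
  have := ((h1 hW).submatrix (Sum.inl ∘ Sum.inl)).conjTranspose_mul_mul_same K.E11
  rw [K.E11_posDef.isHermitian.eq] at this
  rw [W11, hw]
  exact this

theorem W22_posSemidef (K : AlmostKroneckerForm S) (h5 : S.n₅ = 0) (hW : W.PosSemidef) :
    (K.W22 W).PosSemidef := by
  obtain ⟨w, hw, h1, -⟩ := K.exists_What_eq h5 W
  have := ((h1 hW).submatrix (Sum.inl ∘ Sum.inr)).conjTranspose_mul_mul_same K.E22
  rw [K.E22_posDef.isHermitian.eq] at this
  rw [W22, hw]
  exact this

/-- The singular E does not destroy definiteness here: the block is a principal submatrix of a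
congruence transform of W, flanked by the invertible Ê₁₁. -/
theorem W11_posDef (K : AlmostKroneckerForm S) (h5 : S.n₅ = 0) (hW : W.PosDef) :
    (K.W11 W).PosDef := by
  obtain ⟨w, hw, -, h1⟩ := K.exists_What_eq h5 W
  have := ((h1 hW).submatrix (Sum.inl_injective.comp Sum.inl_injective)).conjTranspose_mul_mul_same
    (mulVec_injective_of_isUnit K.E11_posDef.isUnit)
  rw [K.E11_posDef.isHermitian.eq] at this
  rw [W11, hw]
  exact this

theorem W22_posDef (K : AlmostKroneckerForm S) (h5 : S.n₅ = 0) (hW : W.PosDef) :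
    (K.W22 W).PosDef := by
  obtain ⟨w, hw, -, h1⟩ := K.exists_What_eq h5 W
  have := ((h1 hW).submatrix (Sum.inl_injective.comp Sum.inr_injective)).conjTranspose_mul_mul_same
    (mulVec_injective_of_isUnit K.E22_posDef.isUnit)
  rw [K.E22_posDef.isHermitian.eq] at this
  rw [W22, hw]
  exact this

theorem What_isHermitian (K : AlmostKroneckerForm S) (hW : W.IsHermitian) :
    (K.What W).IsHermitian := by
  simp only [IsHermitian, What, conjTranspose_mul, conjTranspose_conjTranspose, hW.eq,
    Matrix.mul_assoc]

theorem W11_isHermitian (K : AlmostKroneckerForm S) (hW : W.IsHermitian) :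
    (K.W11 W).IsHermitian :=
  (K.What_isHermitian hW).submatrix (Sum.inl ∘ Sum.inl ∘ Sum.inl)

theorem W21_conjTranspose (K : AlmostKroneckerForm S) (hW : W.IsHermitian) :
    (K.W21 W)ᴴ = K.W12 W := by
  ext i j
  exact congrFun (congrFun (K.What_isHermitian hW) (.inl (.inl (.inl i)))) (.inl (.inl (.inr j)))

/-- The generalized Lyapunov equation in the coordinates of an almost Kronecker form. -/
theorem genLyapunov_back_iff (K : AlmostKroneckerForm S) (h5 : S.n₅ = 0)
    {Y11 : Matrix (Fin S.n₁) (Fin S.n₁) ℂ} {Y12 : Matrix (Fin S.n₁) (Fin S.n₂) ℂ}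
    {Y13 : Matrix (Fin S.n₁) (Fin S.n₃) ℂ} {Y14 : Matrix (Fin S.n₁) (Fin S.n₁) ℂ}
    {Y21 : Matrix (Fin S.n₂) (Fin S.n₁) ℂ} {Y22 : Matrix (Fin S.n₂) (Fin S.n₂) ℂ}
    {Y23 : Matrix (Fin S.n₂) (Fin S.n₃) ℂ} {Y24 : Matrix (Fin S.n₂) (Fin S.n₁) ℂ}
    {Y31 : Matrix (Fin S.n₃) (Fin S.n₁) ℂ} {Y32 : Matrix (Fin S.n₃) (Fin S.n₂) ℂ}
    {Y33 : Matrix (Fin S.n₃) (Fin S.n₃) ℂ} {Y34 : Matrix (Fin S.n₃) (Fin S.n₁) ℂ}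
    {Y41 : Matrix (Fin S.n₁) (Fin S.n₁) ℂ} {Y42 : Matrix (Fin S.n₁) (Fin S.n₂) ℂ}
    {Y43 : Matrix (Fin S.n₁) (Fin S.n₃) ℂ} {Y44 : Matrix (Fin S.n₁) (Fin S.n₁) ℂ} :
    GenLyapunov E A W (K.back (blocks4
        Y11 Y12 Y13 Y14
        Y21 Y22 Y23 Y24
        Y31 Y32 Y33 Y34
        Y41 Y42 Y43 Y44)) ↔
      (Y11 = 0 ∧ Y12 = 0 ∧ Y13 = 0 ∧ Y21 = 0 ∧ Y23 = 0 ∧ Y31 = 0 ∧ Y32 = 0) ∧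
      K.SolvesDyn W Y22 ∧ K.E11 * Y14 + Y41 * K.E11 = K.W11 W ∧
      Y24 = K.E22⁻¹ * K.W21 W ∧ Y42 = K.W12 W * K.E22⁻¹ := by
  obtain ⟨G, G', H, H', hGG, hGG', hHH, hHH', hE, hA, hY, hW⟩ := K.exists_equivalence h5
  generalize hYdef : blocks4
        Y11 Y12 Y13 Y14
        Y21 Y22 Y23 Y24
        Y31 Y32 Y33 Y34
        Y41 Y42 Y43 Y44 = Y
  have h1 : GenLyapunov E A W (K.back Y) ↔
      (G * E * H)ᴴ * Y * (G * A * H) + (G * A * H)ᴴ * Y * (G * E * H) =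
        -(K.What W).toBlocks₁₁ := by
    have e1 : (G * E * H)ᴴ * Y * (G * A * H) + (G * A * H)ᴴ * Y * (G * E * H) =
        Hᴴ * (Eᴴ * K.back Y * A + Aᴴ * K.back Y * E) * H := by
      rw [hY]
      simp only [conjTranspose_mul, Matrix.mul_assoc, Matrix.mul_add, Matrix.add_mul]
    rw [GenLyapunov, e1, hW]
    refine ⟨fun h => by rw [h, Matrix.mul_neg, Matrix.neg_mul], fun h => ?_⟩
    rw [← Matrix.neg_mul, ← Matrix.mul_neg] at h
    have h2 := congrArg (fun M => H'ᴴ * M * H') h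
    have h3 : H'ᴴ * Hᴴ = 1 := by rw [← conjTranspose_mul, hHH, conjTranspose_one]
    have h4 : ∀ M : Matrix (Fin n) (Fin n) ℂ, H'ᴴ * (Hᴴ * M * H) * H' = M := fun M => by
      calc _ = (H'ᴴ * Hᴴ) * M * (H * H') := by simp only [Matrix.mul_assoc]
        _ = M := by rw [h3, hHH, Matrix.one_mul, Matrix.mul_one]
    simpa only [h4] using h2
  have hE1 := (Matrix.isUnit_iff_isUnit_det _).1 K.E11_posDef.isUnit
  have hE2 := (Matrix.isUnit_iff_isUnit_det _).1 K.E22_posDef.isUnit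
  have l1 : ∀ {m : ℕ} (M : Matrix (Fin S.n₁) (Fin m) ℂ), K.E11 * M = 0 ↔ M = 0 := fun M =>
    ⟨fun h => by rw [← nonsing_inv_mul_cancel_left _ M hE1, h, Matrix.mul_zero],
      fun h => by rw [h, Matrix.mul_zero]⟩
  have l2 : ∀ {m : ℕ} (M : Matrix (Fin S.n₂) (Fin m) ℂ), K.E22 * M = 0 ↔ M = 0 := fun M =>
    ⟨fun h => by rw [← nonsing_inv_mul_cancel_left _ M hE2, h, Matrix.mul_zero],
      fun h => by rw [h, Matrix.mul_zero]⟩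
  have r1 : ∀ {m : ℕ} (M : Matrix (Fin m) (Fin S.n₁) ℂ), M * K.E11 = 0 ↔ M = 0 := fun M =>
    ⟨fun h => by rw [← mul_nonsing_inv_cancel_right _ M hE1, h, Matrix.zero_mul],
      fun h => by rw [h, Matrix.zero_mul]⟩
  have r2 : ∀ {m : ℕ} (M : Matrix (Fin m) (Fin S.n₂) ℂ), M * K.E22 = 0 ↔ M = 0 := fun M =>
    ⟨fun h => by rw [← mul_nonsing_inv_cancel_right _ M hE2, h, Matrix.zero_mul],
      fun h => by rw [h, Matrix.zero_mul]⟩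
  have hl : Y24 = K.E22⁻¹ * K.W21 W ↔ K.E22 * Y24 = K.W21 W :=
    ⟨fun h => by rw [h, mul_nonsing_inv_cancel_left _ _ hE2],
      fun h => by rw [← h, nonsing_inv_mul_cancel_left _ _ hE2]⟩
  have hr : Y42 = K.W12 W * K.E22⁻¹ ↔ Y42 * K.E22 = K.W12 W :=
    ⟨fun h => by rw [h, nonsing_inv_mul_cancel_right _ _ hE2],
      fun h => by rw [← h, mul_nonsing_inv_cancel_right _ _ hE2]⟩
  rw [h1, hE, hA, K.What_toBlocks₁₁ h5, ← hYdef, hl, hr, SolvesDyn]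
  simp only [blocks4_conjTranspose, blocks4_mul, blocks4_add, blocks4_neg, blocks4_inj]
  simp only [K.E11_posDef.isHermitian.eq, K.E22_posDef.isHermitian.eq, conjTranspose_zero,
    conjTranspose_one, conjTranspose_neg, Matrix.mul_zero, Matrix.zero_mul, Matrix.mul_one,
    Matrix.one_mul, Matrix.mul_neg, Matrix.neg_mul, add_zero, zero_add, neg_zero, l1, l2, r1, r2,
    true_and, and_true]
  constructor
  -- Letters number block rows and digits block columns. The discarded (4,1) equation repeats Y₁₁ =
  -- 0 from (1,4). Once the seven zero blocks are substituted, the remaining four equations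
  -- decouple.
  · rintro ⟨a1, a2, a3, a4, b1, b2, b3, b4, c1, c2, -, d2⟩
    subst a3 a4 b3 b4 c1 c2 d2
    simp only [Matrix.mul_zero, Matrix.zero_mul, zero_add, add_zero, neg_inj] at a1 a2 b1 b2
    refine ⟨by simp, b2, ?_, b1, a2⟩
    rw [← neg_inj, ← a1]
    abel
  · rintro ⟨⟨rfl, rfl, rfl, rfl, rfl, rfl, rfl⟩, h1, h2, h3, h4⟩
    simp only [Matrix.mul_zero, Matrix.zero_mul, zero_add, add_zero, neg_inj, true_and, and_true]
    refine ⟨?_, h4, h3, h1⟩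
    rw [← h2]
    abel

/-- The substitution Q = Ê₂₂YÊ₂₂ gives a standard Lyapunov equation; being a congruence, it
preserves definiteness in both directions. -/
theorem solvesDyn_iff (K : AlmostKroneckerForm S) (Y : Matrix (Fin S.n₂) (Fin S.n₂) ℂ) :
    K.SolvesDyn W Y ↔ (K.E22 * Y * K.E22) * (K.E22⁻¹ * K.A22) +
      (K.E22⁻¹ * K.A22)ᴴ * (K.E22 * Y * K.E22) = -K.W22 W := by
  have hE2 := (Matrix.isUnit_iff_isUnit_det _).1 K.E22_posDef.isUnit
  rw [SolvesDyn, conjTranspose_mul, conjTranspose_nonsing_inv, K.E22_posDef.isHermitian.eq]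
  simp only [Matrix.mul_assoc, mul_nonsing_inv_cancel_left _ _ hE2,
    nonsing_inv_mul_cancel_left _ _ hE2]

theorem existsUnique_solvesDyn (K : AlmostKroneckerForm S) (hK : IsHurwitz (K.E22⁻¹ * K.A22))
    (W : Matrix (Fin n) (Fin n) ℂ) : ∃! Y, K.SolvesDyn W Y := by
  have hE2 := (Matrix.isUnit_iff_isUnit_det _).1 K.E22_posDef.isUnit
  obtain ⟨Q, hQ, hu⟩ := hK.existsUnique_lyapunov (K.W22 W)
  refine ⟨K.E22⁻¹ * Q * K.E22⁻¹, ?_, fun Y hY => ?_⟩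
  · beta_reduce
    rw [K.solvesDyn_iff, Matrix.mul_assoc K.E22⁻¹, mul_nonsing_inv_cancel_left _ _ hE2,
      nonsing_inv_mul_cancel_right _ _ hE2]
    exact hQ
  · rw [← hu _ ((K.solvesDyn_iff Y).1 hY), Matrix.mul_assoc K.E22,
      nonsing_inv_mul_cancel_left _ _ hE2, mul_nonsing_inv_cancel_right _ _ hE2]

theorem eq_conj_of_E22 (K : AlmostKroneckerForm S) (Y : Matrix (Fin S.n₂) (Fin S.n₂) ℂ) :
    Y = K.E22⁻¹ᴴ * (K.E22 * Y * K.E22) * K.E22⁻¹ := by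
  have hE2 := (Matrix.isUnit_iff_isUnit_det _).1 K.E22_posDef.isUnit
  rw [conjTranspose_nonsing_inv, K.E22_posDef.isHermitian.eq, Matrix.mul_assoc K.E22,
    nonsing_inv_mul_cancel_left _ _ hE2, mul_nonsing_inv_cancel_right _ _ hE2]

theorem posSemidef_of_solvesDyn (K : AlmostKroneckerForm S) (h5 : S.n₅ = 0)
    (hK : IsHurwitz (K.E22⁻¹ * K.A22)) {Y : Matrix (Fin S.n₂) (Fin S.n₂) ℂ} (hW : W.PosSemidef)
    (hY : K.SolvesDyn W Y) : Y.PosSemidef := by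
  rw [K.eq_conj_of_E22 Y]
  exact (hK.posSemidef_of_lyapunov (K.W22_posSemidef h5 hW)
    ((K.solvesDyn_iff Y).1 hY)).conjTranspose_mul_mul_same _

theorem posDef_of_solvesDyn (K : AlmostKroneckerForm S) (h5 : S.n₅ = 0)
    (hK : IsHurwitz (K.E22⁻¹ * K.A22)) {Y : Matrix (Fin S.n₂) (Fin S.n₂) ℂ} (hW : W.PosDef)
    (hY : K.SolvesDyn W Y) : Y.PosDef := by
  rw [K.eq_conj_of_E22 Y]
  refine (hK.posDef_of_lyapunov (K.W22_posDef h5 hW)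
    ((K.solvesDyn_iff Y).1 hY)).conjTranspose_mul_mul_same ?_
  exact mulVec_injective_of_isUnit
    (isUnit_nonsing_inv_iff.2 K.E22_posDef.isUnit)

/-- The matrix `Eᴴ X E` of a solution is determined by the dynamic part. -/
theorem conjTranspose_mul_mul_unique (K : AlmostKroneckerForm S) (h5 : S.n₅ = 0)
    {X X' : Matrix (Fin n) (Fin n) ℂ}
    (hK : IsHurwitz (K.E22⁻¹ * K.A22)) (hX : GenLyapunov E A W X) (hX' : GenLyapunov E A W X') :
    Eᴴ * X * E = Eᴴ * X' * E := by
  obtain ⟨G, G', H, H', hGG, hGG', hHH, hHH', hE, hA, hY, hW⟩ := K.exists_equivalence h5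
  obtain ⟨Y, rfl⟩ := K.exists_back_eq h5 X
  obtain ⟨Y', rfl⟩ := K.exists_back_eq h5 X'
  have h1 : ∀ Y, Eᴴ * K.back Y * E = H'ᴴ * ((G * E * H)ᴴ * Y * (G * E * H)) * H' := by
    intro Y
    have h3 : H'ᴴ * Hᴴ = 1 := by rw [← conjTranspose_mul, hHH, conjTranspose_one]
    calc Eᴴ * K.back Y * E = (H'ᴴ * Hᴴ) * (Eᴴ * K.back Y * E) * (H * H') := by
          rw [h3, hHH, Matrix.one_mul, Matrix.mul_one]
      _ = _ := by rw [hY]; simp only [conjTranspose_mul, Matrix.mul_assoc]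
  rw [h1, h1, hE]
  obtain ⟨a11, a12, a13, a14, a21, a22, a23, a24, a31, a32, a33, a34, a41, a42, a43, a44, rfl⟩ :=
    exists_eq_blocks4 Y
  obtain ⟨b11, b12, b13, b14, b21, b22, b23, b24, b31, b32, b33, b34, b41, b42, b43, b44, rfl⟩ :=
    exists_eq_blocks4 Y'
  rw [K.genLyapunov_back_iff h5] at hX hX'
  obtain ⟨⟨rfl, rfl, rfl, rfl, rfl, rfl, rfl⟩, h2, -⟩ := hX
  obtain ⟨⟨rfl, rfl, rfl, rfl, rfl, rfl, rfl⟩, h3, -⟩ := hX'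
  obtain rfl := (K.existsUnique_solvesDyn hK W).unique h2 h3
  -- The vanishing of Y₁₁, Y₁₂ and Y₂₁ leaves Ê₂₂Y₂₂Ê₂₂ as the only block of the product.
  congr 2
  simp [blocks4_conjTranspose, blocks4_mul]

theorem hermitian_E11_iff (K : AlmostKroneckerForm S) {Y : Matrix (Fin S.n₁) (Fin S.n₁) ℂ}
    (hY : Y.IsHermitian) : K.E11 * Y + Yᴴ * K.E11 = K.W11 W ↔
      Y * (-K.E11) + (-K.E11)ᴴ * Y = -K.W11 W := by
  rw [hY.eq, conjTranspose_neg, K.E11_posDef.isHermitian.eq, Matrix.mul_neg, Matrix.neg_mul,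
    ← neg_add, neg_inj, add_comm]

theorem existsUnique_isHermitian_Y14 (K : AlmostKroneckerForm S) (hW : W.IsHermitian) :
    ∃! Y : Matrix (Fin S.n₁) (Fin S.n₁) ℂ,
      Y.IsHermitian ∧ K.E11 * Y + Yᴴ * K.E11 = K.W11 W := by
  have hH := isHurwitz_neg_of_posDef K.E11_posDef
  obtain ⟨Q, hQ, hu⟩ := hH.existsUnique_lyapunov (K.W11 W)
  have hQh := hH.isHermitian_of_lyapunov (K.W11_isHermitian hW) hQ
  exact ⟨Q, ⟨hQh, (K.hermitian_E11_iff hQh).2 hQ⟩,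
    fun Y hY => hu _ ((K.hermitian_E11_iff hY.1).1 hY.2)⟩

end AlmostKroneckerForm

/-! ### The spectral projection and definiteness on its image -/

section SpectralProjection

variable {n : ℕ} {E A Pl : Matrix (Fin n) (Fin n) ℂ}

/-- Weierstrass decompositions may be indexed by arbitrary finite types. -/
theorem IsLeftSpectralProjection.of_fintype {p q : Type*} [Fintype p] [Fintype q] [DecidableEq p]
    [DecidableEq q] (U : Matrix (Fin n) (p ⊕ q) ℂ) (U' : Matrix (p ⊕ q) (Fin n) ℂ)
    (T : Matrix (p ⊕ q) (Fin n) ℂ) (T' : Matrix (Fin n) (p ⊕ q) ℂ) (Λ : Matrix p p ℂ)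
    (N : Matrix q q ℂ) (hU : U * U' = 1) (hU' : U' * U = 1) (hT : T * T' = 1) (hT' : T' * T = 1)
    (hN : IsNilpotent N) (hE : E = U * (fromBlocks 1 0 0 N : Matrix (p ⊕ q) (p ⊕ q) ℂ) * T)
    (hA : A = U * (fromBlocks Λ 0 0 1 : Matrix (p ⊕ q) (p ⊕ q) ℂ) * T) :
    IsLeftSpectralProjection E A (U * (fromBlocks 1 0 0 0 : Matrix (p ⊕ q) (p ⊕ q) ℂ) * U') := by
  let e := Fintype.equivFin p
  let f := Fintype.equivFin q
  let g : Fin (Fintype.card p) ⊕ Fin (Fintype.card q) ≃ p ⊕ q := (Equiv.sumCongr e f).symm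
  have hb : ∀ (a : Matrix p p ℂ) (c : Matrix q q ℂ),
      (fromBlocks a 0 0 c).submatrix g g =
        fromBlocks (a.submatrix e.symm e.symm) 0 0 (c.submatrix f.symm f.symm) := by
    intro a c
    ext (i | i) (j | j) <;> rfl
  have hmul : ∀ (M : Matrix (p ⊕ q) (p ⊕ q) ℂ) (V : Matrix (p ⊕ q) (Fin n) ℂ),
      U * M * V = U.submatrix id g * M.submatrix g g * V.submatrix g id := by
    intro M V
    rw [submatrix_mul_equiv, submatrix_mul_equiv, submatrix_id_id]
  refine ⟨Fintype.card p, Fintype.card q, U.submatrix id g, U'.submatrix g id, T.submatrix g id,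
    T'.submatrix id g, Λ.submatrix e.symm e.symm, N.submatrix f.symm f.symm, ?_, ?_, ?_, ?_, ?_,
    ?_, ?_, ?_⟩
  · rw [submatrix_mul_equiv, hU, submatrix_id_id]
  · rw [← submatrix_mul _ _ _ _ _ Function.bijective_id, hU', submatrix_one_equiv]
  · rw [← submatrix_mul _ _ _ _ _ Function.bijective_id, hT, submatrix_one_equiv]
  · rw [submatrix_mul_equiv, hT', submatrix_id_id]
  · exact hN.map (reindexRingEquiv ℂ f)
  · rw [hE, hmul, hb, submatrix_one_equiv]
  · rw [hA, hmul, hb, submatrix_one_equiv]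
  · rw [hmul, hb, submatrix_one_equiv, submatrix_zero]
    rfl

/-- Replacing Â₂₂ by Ê₂₂ in the transformed A gives an invertible M. Multiplication by M⁻¹ takes A
to diag(1, Ê₂₂⁻¹Â₂₂, 1, 1) and E to the identity in block (2,2) plus Ê₁₁ in block (4,1). Listing the
second block first gives a Weierstrass decomposition. -/
theorem AlmostKroneckerForm.exists_isLeftSpectralProjection {S : PencilStaircaseForm E A}
    (K : AlmostKroneckerForm S) (h5 : S.n₅ = 0) : ∃ Pl, IsLeftSpectralProjection E A Pl := by
  obtain ⟨G, G', H, H', hGG, hGG', hHH, hHH', hE, hA, -, -⟩ := K.exists_equivalence h5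
  have hE2 := (Matrix.isUnit_iff_isUnit_det _).1 K.E22_posDef.isUnit
  let g : Fin S.n₂ ⊕ (Fin S.n₁ ⊕ (Fin S.n₃ ⊕ Fin S.n₁)) ≃ Idx4 S.n₁ S.n₂ S.n₃ :=
    ((Equiv.sumAssoc _ _ _).symm.trans (Equiv.sumCongr (Equiv.sumComm _ _) (Equiv.refl _)))
  obtain ⟨M, hM⟩ : ∃ M : Matrix (Idx4 S.n₁ S.n₂ S.n₃) (Idx4 S.n₁ S.n₂ S.n₃) ℂ, M = blocks4
    0 0 0 1
    0 K.E22 0 0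
    0 0 1 0
    (-1) 0 0 0 := ⟨_, rfl⟩
  obtain ⟨M', hM'⟩ : ∃ M : Matrix (Idx4 S.n₁ S.n₂ S.n₃) (Idx4 S.n₁ S.n₂ S.n₃) ℂ, M = blocks4
    0 0 0 (-1)
    0 K.E22⁻¹ 0 0
    0 0 1 0
    1 0 0 0 := ⟨_, rfl⟩
  have h1 : blocks4 1 0 0 0 0 1 0 0 0 0 1 0 0 0 0 1 =
      (1 : Matrix (Idx4 S.n₁ S.n₂ S.n₃) (Idx4 S.n₁ S.n₂ S.n₃) ℂ) := by
    simp [blocks4]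
  have hMM : M * M' = 1 := by
    rw [hM, hM', blocks4_mul, ← h1, blocks4_inj]
    simp [mul_nonsing_inv _ hE2]
  have hMM' : M' * M = 1 := by
    rw [hM, hM', blocks4_mul, ← h1, blocks4_inj]
    simp [nonsing_inv_mul _ hE2]
  have hE' : G * E * H = M * blocks4 0 0 0 0 0 1 0 0 0 0 0 0 K.E11 0 0 0 := by
    rw [hE, hM, blocks4_mul, blocks4_inj]
    simp
  have hA' : G * A * H = M * blocks4 1 0 0 0 0 (K.E22⁻¹ * K.A22) 0 0 0 0 1 0 0 0 0 1 := by
    rw [hA, hM, blocks4_mul, blocks4_inj]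
    simp [mul_nonsing_inv_cancel_left _ _ hE2]
  have hback : ∀ B : Matrix (Fin n) (Fin n) ℂ, B = G' * (G * B * H) * H' := by
    intro B
    calc B = (G' * G) * B * (H * H') := by rw [hGG', hHH, Matrix.one_mul, Matrix.mul_one]
      _ = _ := by simp only [Matrix.mul_assoc]
  have hmul : ∀ D : Matrix (Idx4 S.n₁ S.n₂ S.n₃) (Idx4 S.n₁ S.n₂ S.n₃) ℂ,
      (G' * M).submatrix id g * D.submatrix g g * H'.submatrix g id = G' * (M * D) * H' := by
    intro D
    rw [submatrix_mul_equiv, submatrix_mul_equiv, submatrix_id_id]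
    simp only [Matrix.mul_assoc]
  -- The nilpotent part maps the first block into the fourth and kills the rest, so its square is
  -- zero.
  refine ⟨_, IsLeftSpectralProjection.of_fintype ((G' * M).submatrix id g)
    ((M' * G).submatrix g id) (H'.submatrix g id) (H.submatrix id g) (K.E22⁻¹ * K.A22)
    (fromBlocks 0 0 (fromRows 0 K.E11) 0) ?_ ?_ ?_ ?_ ⟨2, ?_⟩ ?_ ?_⟩
  · rw [submatrix_mul_equiv, Matrix.mul_assoc, ← Matrix.mul_assoc M, hMM, Matrix.one_mul, hGG',
      submatrix_id_id]
  · rw [← submatrix_mul _ _ _ _ _ Function.bijective_id, Matrix.mul_assoc, ← Matrix.mul_assoc G,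
      hGG, Matrix.one_mul, hMM', submatrix_one_equiv]
  · rw [← submatrix_mul _ _ _ _ _ Function.bijective_id, hHH', submatrix_one_equiv]
  · rw [submatrix_mul_equiv, hHH, submatrix_id_id]
  · simp [pow_two, fromBlocks_multiply]
  · conv_lhs => rw [hback E, hE', ← hmul]
    congr 2
    ext (i | (i | (i | i))) (j | (j | (j | j))) <;> simp [g, blocks4]
  · conv_lhs => rw [hback A, hA', ← hmul]
    congr 2
    ext (i | (i | (i | i))) (j | (j | (j | j))) <;>
      simp [g, blocks4, Matrix.one_apply]

/-- High powers of `E A⁻¹` have the range and the kernel of the spectral projection. -/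
theorem IsLeftSpectralProjection.exists_pow (hA : IsUnit A) (h : IsLeftSpectralProjection E A Pl) :
    ∃ m₀ : ℕ, ∀ m ≥ m₀, ∃ H : Matrix (Fin n) (Fin n) ℂ,
      Pl = (E * A⁻¹) ^ m * H ∧ Pl = H * (E * A⁻¹) ^ m ∧
      Pl * (E * A⁻¹) ^ m = (E * A⁻¹) ^ m ∧ (E * A⁻¹) ^ m * Pl = (E * A⁻¹) ^ m := by
  obtain ⟨k, l, U, U', T, T', Λ, N, hU, hU', hT, hT', ⟨m₀, hN⟩, hE, hA', hPl⟩ := h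
  have hAd := (Matrix.isUnit_iff_isUnit_det _).1 hA
  have hΛ : IsUnit Λ.det := by
    have h1 : (fromBlocks Λ 0 0 1 : Matrix (Fin k ⊕ Fin l) (Fin k ⊕ Fin l) ℂ) *
        (T * A⁻¹ * U) = 1 := by
      calc _ = U' * U * (fromBlocks Λ 0 0 1 : Matrix (Fin k ⊕ Fin l) (Fin k ⊕ Fin l) ℂ) *
              (T * A⁻¹ * U) := by
            rw [hU', Matrix.one_mul]
        _ = U' * ((U *
              (fromBlocks Λ 0 0 1 : Matrix (Fin k ⊕ Fin l) (Fin k ⊕ Fin l) ℂ) * T) * A⁻¹) * U := by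
            simp only [Matrix.mul_assoc]
        _ = 1 := by rw [← hA', mul_nonsing_inv _ hAd, Matrix.mul_one, hU']
    have h2 := isUnit_det_of_right_inverse h1
    simpa [det_fromBlocks_zero₁₂] using h2
  have hconj : ∀ X Y : Matrix (Fin k ⊕ Fin l) (Fin k ⊕ Fin l) ℂ,
      (U * X * U') * (U * Y * U') = U * (X * Y) * U' := by
    intro X Y
    calc _ = U * X * (U' * U) * Y * U' := by simp only [Matrix.mul_assoc]
      _ = _ := by rw [hU', Matrix.mul_one, Matrix.mul_assoc U]
  have hM : E * A⁻¹ =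
      U * (fromBlocks Λ⁻¹ 0 0 N : Matrix (Fin k ⊕ Fin l) (Fin k ⊕ Fin l) ℂ) * U' := by
    have h1 : E =
        (U * (fromBlocks Λ⁻¹ 0 0 N : Matrix (Fin k ⊕ Fin l) (Fin k ⊕ Fin l) ℂ) * U') * A := by
      rw [hA']
      calc E = U * (fromBlocks Λ⁻¹ 0 0 N *
              (fromBlocks Λ 0 0 1 : Matrix (Fin k ⊕ Fin l) (Fin k ⊕ Fin l) ℂ)) * T := by
            rw [hE, fromBlocks_multiply]
            simp [nonsing_inv_mul _ hΛ]
        _ = U * (fromBlocks Λ⁻¹ 0 0 N : Matrix (Fin k ⊕ Fin l) (Fin k ⊕ Fin l) ℂ) * (U' * U) *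
              (fromBlocks Λ 0 0 1 : Matrix (Fin k ⊕ Fin l) (Fin k ⊕ Fin l) ℂ) * T := by
            rw [hU', Matrix.mul_one]; simp only [Matrix.mul_assoc]
        _ = _ := by simp only [Matrix.mul_assoc]
    conv_lhs => rw [h1]
    rw [mul_nonsing_inv_cancel_right _ _ hAd]
  have hMm : ∀ m, (E * A⁻¹) ^ m =
      U * (fromBlocks (Λ⁻¹ ^ m) 0 0 (N ^ m) : Matrix (Fin k ⊕ Fin l) (Fin k ⊕ Fin l) ℂ) * U' := by
    intro m
    induction m with
    | zero => simp [hU]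
    | succ m ih => rw [pow_succ, ih, hM, hconj, fromBlocks_multiply]; simp [pow_succ]
  -- Here EA⁻¹ = U diag(Λ⁻¹, N) U⁻¹. Past the nilpotency exponent only Λ⁻ᵐ survives, and the witness
  -- inverts it on the range of Pₗ.
  refine ⟨m₀, fun m hm =>
    ⟨U * (fromBlocks (Λ ^ m) 0 0 0 : Matrix (Fin k ⊕ Fin l) (Fin k ⊕ Fin l) ℂ) * U', ?_⟩⟩
  have hNm : N ^ m = 0 := pow_eq_zero_of_le hm hN
  have hc : Commute Λ⁻¹ Λ := by
    rw [Commute, SemiconjBy, nonsing_inv_mul _ hΛ, mul_nonsing_inv _ hΛ]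
  have hp1 : Λ⁻¹ ^ m * Λ ^ m = 1 := by rw [← hc.mul_pow, nonsing_inv_mul _ hΛ, one_pow]
  have hp2 : Λ ^ m * Λ⁻¹ ^ m = 1 := by rw [← hc.symm.mul_pow, mul_nonsing_inv _ hΛ, one_pow]
  rw [hMm, hNm, hPl, hconj, hconj, hconj, hconj]
  simp only [fromBlocks_multiply, hp1, hp2, Matrix.mul_zero, Matrix.zero_mul, add_zero,
    Matrix.mul_one, Matrix.one_mul, and_self]

/-- The range and kernel of a spectral projection are those of a high power of EA⁻¹, which does not
depend on the decomposition. Hence each of two such projections absorbs the other, Pₗ = Pₗ'Pₗ = Pₗ'.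
-/
theorem IsLeftSpectralProjection.unique {Pl' : Matrix (Fin n) (Fin n) ℂ} (hA : IsUnit A)
    (h : IsLeftSpectralProjection E A Pl) (h' : IsLeftSpectralProjection E A Pl') : Pl = Pl' := by
  obtain ⟨m, hm⟩ := h.exists_pow hA
  obtain ⟨m', hm'⟩ := h'.exists_pow hA
  obtain ⟨H, h1, -, -, h4⟩ := hm (m + m') (by omega)
  obtain ⟨H', -, h2', h3', -⟩ := hm' (m + m') (by omega)
  calc Pl = Pl' * Pl := by
        conv_rhs => rw [h1, ← Matrix.mul_assoc, h3', ← h1]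
    _ = Pl' := by
        conv_lhs => rw [h2', Matrix.mul_assoc, h4, ← h2']

/-- A kernel vector of A would be an eigenvector of the pencil for the eigenvalue 0, which is not in
the open left half-plane. -/
theorem PencilStable.isUnit (h : PencilStable E A) : IsUnit A := by
  rw [Matrix.isUnit_iff_isUnit_det, isUnit_iff_ne_zero]
  intro h0
  obtain ⟨v, hv, hz⟩ := Matrix.exists_mulVec_eq_zero_iff.2 h0
  simpa using h 0 v hv (by simpa using hz)

/-- On the range of the spectral projection, solutions of the generalized Lyapunov equation are
congruent to solutions of a Lyapunov equation. -/
theorem IsLeftSpectralProjection.exists_lyapunov {W X : Matrix (Fin n) (Fin n) ℂ}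
    (hst : PencilStable E A) (h : IsLeftSpectralProjection E A Pl) (hX : GenLyapunov E A W X) :
    ∃ (k : ℕ) (V : Matrix (Fin n) (Fin k) ℂ) (Λ : Matrix (Fin k) (Fin k) ℂ),
      IsHurwitz Λ ∧ Function.Injective V.mulVec ∧ (∀ x ∈ image Pl, ∃ c, x = V *ᵥ c) ∧
      (Vᴴ * X * V) * Λ + Λᴴ * (Vᴴ * X * V) = -(Vᴴ * W * V) := by
  obtain ⟨k, l, U, U', T, T', Λ, N, hU, hU', hT, hT', -, hE, hA, hPl⟩ := h
  let I : Matrix (Fin k ⊕ Fin l) (Fin k) ℂ := fromRows 1 0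
  have hI : Function.Injective I.mulVec := by
    refine Function.LeftInverse.injective (g := fun v => v ∘ Sum.inl) fun v => ?_
    simp [I, fromRows_mulVec]
  have hEV : E * (T' * I) = U * I := by
    calc _ = U * (fromBlocks 1 0 0 N : Matrix (Fin k ⊕ Fin l) (Fin k ⊕ Fin l) ℂ) *
            (T * T') * I := by
          rw [hE]; simp only [Matrix.mul_assoc]
      _ = U * I := by
        rw [hT, Matrix.mul_one, Matrix.mul_assoc, fromBlocks_mul_fromRows]; simp [I]
  have hAV : A * (T' * I) = U * I * Λ := by
    calc _ = U * (fromBlocks Λ 0 0 1 : Matrix (Fin k ⊕ Fin l) (Fin k ⊕ Fin l) ℂ) *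
            (T * T') * I := by
          rw [hA]; simp only [Matrix.mul_assoc]
      _ = U * I * Λ := by
        rw [hT, Matrix.mul_one, Matrix.mul_assoc, fromBlocks_mul_fromRows, Matrix.mul_assoc,
          fromRows_mul]
        simp
  -- The columns of T'I and UI span the right and left deflating subspaces: E(T'I) = UI and A(T'I) =
  -- UIΛ. Compressing the generalized equation by T'I therefore gives a Lyapunov equation for
  -- (UI)ᴴX(UI).
  refine ⟨k, U * I, Λ, ?_, ?_, ?_, ?_⟩
  · intro z c hc hz
    refine hst z ((T' * I) *ᵥ c) (fun h0 => hc (hI ?_)) ?_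
    · have := congrArg (T *ᵥ ·) h0
      simpa only [mulVec_mulVec, ← Matrix.mul_assoc, hT, Matrix.one_mul, mulVec_zero] using this
    · rw [mulVec_mulVec, hAV, ← mulVec_mulVec, hz, mulVec_smul, mulVec_mulVec, hEV]
  · refine Function.Injective.of_comp (f := U'.mulVec) ?_
    convert hI using 1
    ext v : 1
    rw [Function.comp_apply, mulVec_mulVec, ← Matrix.mul_assoc, hU', Matrix.one_mul]
  · rintro x ⟨y, rfl⟩
    refine ⟨(U' *ᵥ y) ∘ Sum.inl, ?_⟩
    rw [mulVecLin_apply, hPl, ← mulVec_mulVec, ← mulVec_mulVec, ← mulVec_mulVec, fromBlocks_mulVec,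
      fromRows_mulVec]
    simp
  · have := congrArg (fun M => (T' * I)ᴴ * M * (T' * I)) hX
    simp only [Matrix.mul_add, Matrix.add_mul, Matrix.mul_neg, Matrix.neg_mul] at this
    have h1 : (U * I)ᴴ * X * (U * I) * Λ = (T' * I)ᴴ * (Eᴴ * X * A) * (T' * I) := by
      rw [Matrix.mul_assoc _ (U * I) Λ, ← hAV, ← hEV, Matrix.conjTranspose_mul E]
      simp only [Matrix.mul_assoc]
    have h2 : Λᴴ * ((U * I)ᴴ * X * (U * I)) = (T' * I)ᴴ * (Aᴴ * X * E) * (T' * I) := by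
      calc _ = (U * I * Λ)ᴴ * X * (U * I) := by
            rw [Matrix.conjTranspose_mul (U * I)]
            simp only [Matrix.mul_assoc]
        _ = _ := by
            rw [← hAV, ← hEV, Matrix.conjTranspose_mul A]
            simp only [Matrix.mul_assoc]
    rw [h1, h2, this, ← hEV, Matrix.conjTranspose_mul E]
    simp only [Matrix.mul_assoc]

theorem star_dotProduct_conj_mulVec {k : ℕ} (V : Matrix (Fin n) (Fin k) ℂ)
    (X : Matrix (Fin n) (Fin n) ℂ) (c : Fin k → ℂ) :
    star (V *ᵥ c) ⬝ᵥ (X *ᵥ (V *ᵥ c)) = star c ⬝ᵥ ((Vᴴ * X * V) *ᵥ c) := by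
  rw [star_mulVec, ← dotProduct_mulVec, mulVec_mulVec, mulVec_mulVec, Matrix.mul_assoc]

theorem IsLeftSpectralProjection.posSemidefOn {W X : Matrix (Fin n) (Fin n) ℂ}
    (hst : PencilStable E A) (h : IsLeftSpectralProjection E A Pl) (hX : GenLyapunov E A W X)
    (hW : W.PosSemidef) : PosSemidefOn X (image Pl) := by
  obtain ⟨k, V, Λ, hΛ, hV, hc, hL⟩ := h.exists_lyapunov hst hX
  intro x hx
  obtain ⟨c, rfl⟩ := hc x hx
  rw [star_dotProduct_conj_mulVec]
  exact (hΛ.posSemidef_of_lyapunov (hW.conjTranspose_mul_mul_same V) hL).dotProduct_mulVec_nonneg c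

theorem IsLeftSpectralProjection.posDefOn {W X : Matrix (Fin n) (Fin n) ℂ}
    (hst : PencilStable E A) (h : IsLeftSpectralProjection E A Pl) (hX : GenLyapunov E A W X)
    (hW : W.PosDef) : PosDefOn X (image Pl) := by
  obtain ⟨k, V, Λ, hΛ, hV, hc, hL⟩ := h.exists_lyapunov hst hX
  intro x hx hx0
  obtain ⟨c, rfl⟩ := hc x hx
  rw [star_dotProduct_conj_mulVec]
  refine (hΛ.posDef_of_lyapunov (hW.conjTranspose_mul_mul_same hV) hL).dotProduct_mulVec_pos ?_
  rintro rfl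
  simp at hx0

end SpectralProjection

/-! ### Existence of staircase forms -/

section Staircase

variable {n : ℕ} {E A : Matrix (Fin n) (Fin n) ℂ}

/-- A staircase form from orthonormal bases, given as columns of matrices, of the four subspaces. -/
theorem nonempty_staircaseForm_of_columns {J R : Matrix (Fin n) (Fin n) ℂ} {n₁ n₂ n₃ : ℕ}
    (hE : E.IsHermitian) (hJ : Jᴴ = -J) (hR : R.IsHermitian)
    (hn : (n₁ + n₂) + (n₃ + n₁) = n)
    {B₁ : Matrix (Fin n) (Fin n₁) ℂ} {B₂ : Matrix (Fin n) (Fin n₂) ℂ}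
    {B₃ : Matrix (Fin n) (Fin n₃) ℂ} {B₄ : Matrix (Fin n) (Fin n₁) ℂ}
    (h11 : B₁ᴴ * B₁ = 1) (h22 : B₂ᴴ * B₂ = 1) (h33 : B₃ᴴ * B₃ = 1) (h44 : B₄ᴴ * B₄ = 1)
    (h12 : B₁ᴴ * B₂ = 0) (h13 : B₁ᴴ * B₃ = 0) (h14 : B₁ᴴ * B₄ = 0) (h23 : B₂ᴴ * B₃ = 0)
    (h24 : B₂ᴴ * B₄ = 0) (h34 : B₃ᴴ * B₄ = 0)
    (hE3 : E * B₃ = 0) (hE4 : E * B₄ = 0) (hR4 : R * B₄ = 0)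
    (hJ24 : B₂ᴴ * J * B₄ = 0) (hJ34 : B₃ᴴ * J * B₄ = 0) (hJ44 : B₄ᴴ * J * B₄ = 0)
    (hE12 : (fromBlocks (B₁ᴴ * E * B₁) (B₁ᴴ * E * B₂) (B₂ᴴ * E * B₁) (B₂ᴴ * E * B₂)).PosDef)
    (hJ14 : IsUnit (B₁ᴴ * J * B₄)) (hA33 : IsUnit (B₃ᴴ * (J - R) * B₃)) :
    Nonempty (StaircaseForm E J R) := by
  have hsw : ∀ {a b : ℕ} {X : Matrix (Fin n) (Fin a) ℂ} {Y : Matrix (Fin n) (Fin b) ℂ},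
      Xᴴ * Y = 0 → Yᴴ * X = 0 := by
    intro a b X Y h
    simpa using congrArg conjTranspose h
  let P : Matrix (Idx5 n₁ n₂ n₃ 0) (Fin n) ℂ :=
    fromRows (fromRows (fromRows B₁ᴴ B₂ᴴ) (fromRows B₃ᴴ B₄ᴴ)) 0
  have hP : Pᴴ = fromCols (fromCols (fromCols B₁ B₂) (fromCols B₃ B₄)) 0 := by
    simp [P, conjTranspose_fromRows_eq_fromCols_conjTranspose]
  have hconj : ∀ X : Matrix (Fin n) (Fin n) ℂ, P * X * Pᴴ = border 0 (blocks4
      (B₁ᴴ * X * B₁) (B₁ᴴ * X * B₂) (B₁ᴴ * X * B₃) (B₁ᴴ * X * B₄)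
      (B₂ᴴ * X * B₁) (B₂ᴴ * X * B₂) (B₂ᴴ * X * B₃) (B₂ᴴ * X * B₄)
      (B₃ᴴ * X * B₁) (B₃ᴴ * X * B₂) (B₃ᴴ * X * B₃) (B₃ᴴ * X * B₄)
      (B₄ᴴ * X * B₁) (B₄ᴴ * X * B₂) (B₄ᴴ * X * B₃) (B₄ᴴ * X * B₄)) := by
    intro X
    rw [hP]
    simp only [P, fromRows_mul, mul_fromCols, Matrix.zero_mul, Matrix.mul_zero]
    ext (((i | i) | (i | i)) | i) (((j | j) | (j | j)) | j) <;> rfl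
  have hPP : P * Pᴴ = 1 := by
    have h1 := hconj 1
    rw [Matrix.mul_one] at h1
    rw [h1]
    simp only [Matrix.mul_one, h11, h22, h33, h44, h12, h13, h14, h23, h24, h34, hsw h12, hsw h13,
      hsw h14, hsw h23, hsw h24, hsw h34]
    ext (((i | i) | (i | i)) | i) (((j | j) | (j | j)) | j) <;>
      first
        | exact i.elim0
        | exact j.elim0
        | simp [border, blocks4, Matrix.one_apply]
  -- The dimension count makes P square, so the one-sided inverse is two-sided.
  have hPP' : Pᴴ * P = 1 :=
    (mul_eq_one_comm_of_card_eq _ _ _ (by simp [Fintype.card_sum, hn])).1 hPP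
  have hE3' : ∀ {a : ℕ} (X : Matrix (Fin n) (Fin a) ℂ), B₃ᴴ * E * X = 0 := fun X => by
    have := congrArg conjTranspose hE3
    rw [Matrix.conjTranspose_mul, hE.eq, conjTranspose_zero] at this
    rw [this, Matrix.zero_mul]
  have hE4' : ∀ {a : ℕ} (X : Matrix (Fin n) (Fin a) ℂ), B₄ᴴ * E * X = 0 := fun X => by
    have := congrArg conjTranspose hE4
    rw [Matrix.conjTranspose_mul, hE.eq, conjTranspose_zero] at this
    rw [this, Matrix.zero_mul]
  have hR4' : ∀ {a : ℕ} (X : Matrix (Fin n) (Fin a) ℂ), B₄ᴴ * R * X = 0 := fun X => by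
    have := congrArg conjTranspose hR4
    rw [Matrix.conjTranspose_mul, hR.eq, conjTranspose_zero] at this
    rw [this, Matrix.zero_mul]
  have hEs : ∀ {a b : ℕ} (X : Matrix (Fin n) (Fin a) ℂ) (Y : Matrix (Fin n) (Fin b) ℂ),
      (Xᴴ * E * Y)ᴴ = Yᴴ * E * X := fun X Y => by
    simp [Matrix.conjTranspose_mul, hE.eq, Matrix.mul_assoc]
  have hRs : ∀ {a b : ℕ} (X : Matrix (Fin n) (Fin a) ℂ) (Y : Matrix (Fin n) (Fin b) ℂ),
      (Xᴴ * R * Y)ᴴ = Yᴴ * R * X := fun X Y => by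
    simp [Matrix.conjTranspose_mul, hR.eq, Matrix.mul_assoc]
  have hJs : ∀ {a b : ℕ} (X : Matrix (Fin n) (Fin a) ℂ) (Y : Matrix (Fin n) (Fin b) ℂ),
      (Xᴴ * J * Y)ᴴ = -(Yᴴ * J * X) := fun X Y => by
    simp [Matrix.conjTranspose_mul, hJ, Matrix.mul_assoc]
  have hJ42 : B₄ᴴ * J * B₂ = 0 := by simpa [hJs] using congrArg conjTranspose hJ24
  have hJ43 : B₄ᴴ * J * B₃ = 0 := by simpa [hJs] using congrArg conjTranspose hJ34
  exact ⟨{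
    n₁ := n₁, n₂ := n₂, n₃ := n₃, n₅ := 0
    P := P
    mul_conjTranspose := hPP
    conjTranspose_mul := hPP'
    E11 := B₁ᴴ * E * B₁, E21 := B₂ᴴ * E * B₁, E22 := B₂ᴴ * E * B₂
    J11 := B₁ᴴ * J * B₁, J21 := B₂ᴴ * J * B₁, J22 := B₂ᴴ * J * B₂
    J31 := B₃ᴴ * J * B₁, J32 := B₃ᴴ * J * B₂, J33 := B₃ᴴ * J * B₃, J41 := B₄ᴴ * J * B₁
    R11 := B₁ᴴ * R * B₁, R21 := B₂ᴴ * R * B₁, R22 := B₂ᴴ * R * B₂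
    R31 := B₃ᴴ * R * B₁, R32 := B₃ᴴ * R * B₂, R33 := B₃ᴴ * R * B₃
    E_eq := by
      rw [hconj, hEs]
      simp only [Matrix.mul_assoc _ E B₃, Matrix.mul_assoc _ E B₄, hE3, hE4, hE3', hE4',
        Matrix.mul_zero]
    J_eq := by
      rw [hconj, hJs, hJs, hJs, hJs]
      simp only [neg_neg, hJ24, hJ34, hJ44, hJ42, hJ43]
    R_eq := by
      rw [hconj, hRs, hRs, hRs]
      simp only [Matrix.mul_assoc _ R B₄, hR4, hR4', Matrix.mul_zero]
    E_posDef := by rwa [hEs]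
    E11_posDef := hE12.submatrix Sum.inl_injective
    E22_posDef := hE12.submatrix Sum.inr_injective
    J41_isUnit := by
      rw [← neg_neg (B₄ᴴ * J * B₁), ← hJs]
      exact ((isUnit_conjTranspose _).2 hJ14).neg
    A33_isUnit := by rwa [← Matrix.sub_mul, ← Matrix.mul_sub] }⟩

/-- Orthonormal bases of subspaces as columns of matrices. -/
theorem exists_orthonormal_columns (V : Submodule ℂ (EuclideanSpace ℂ (Fin n))) {k : ℕ}
    (hk : Module.finrank ℂ V = k) :
    ∃ B : Matrix (Fin n) (Fin k) ℂ, Bᴴ * B = 1 ∧ (∀ c, WithLp.toLp 2 (B *ᵥ c) ∈ V) ∧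
      ∀ x ∈ V, ∃ c, x = WithLp.toLp 2 (B *ᵥ c) := by
  let b := (stdOrthonormalBasis ℂ V).reindex (finCongr hk)
  have hB : ∀ c : Fin k → ℂ, WithLp.toLp 2
      ((Matrix.of fun i j => (b j : EuclideanSpace ℂ (Fin n)) i) *ᵥ c) =
      ((∑ j, c j • b j : V) : EuclideanSpace ℂ (Fin n)) := by
    intro c
    ext i
    simp [mulVec, dotProduct, mul_comm]
  refine ⟨Matrix.of fun i j => (b j : EuclideanSpace ℂ (Fin n)) i, ?_, fun c => ?_, fun x hx => ?_⟩
  · ext i j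
    have := orthonormal_iff_ite.1 b.orthonormal i j
    rw [Matrix.one_apply, ← this, Submodule.coe_inner, EuclideanSpace.inner_eq_star_dotProduct]
    simp [Matrix.mul_apply, dotProduct, mul_comm]
  · rw [hB]
    exact Submodule.coe_mem _
  · refine ⟨fun j => b.repr ⟨x, hx⟩ j, ?_⟩
    rw [hB, b.sum_repr]

theorem star_dotProduct_mulVec_eq_inner {a b : ℕ} (B : Matrix (Fin n) (Fin a) ℂ)
    (X : Matrix (Fin n) (Fin n) ℂ) (C : Matrix (Fin n) (Fin b) ℂ) (c : Fin a → ℂ) (d : Fin b → ℂ) :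
    star c ⬝ᵥ ((Bᴴ * X * C) *ᵥ d) =
      inner ℂ (WithLp.toLp 2 (B *ᵥ c)) (toEuclideanLin X (WithLp.toLp 2 (C *ᵥ d))) := by
  rw [toLpLin_toLp, EuclideanSpace.inner_toLp_toLp, dotProduct_comm (toLin' X _), star_mulVec,
    ← dotProduct_mulVec, toLin'_apply, mulVec_mulVec, mulVec_mulVec, Matrix.mul_assoc]

theorem eq_zero_of_star_dotProduct_mulVec {a b : ℕ} {M : Matrix (Fin a) (Fin b) ℂ}
    (h : ∀ c d, star c ⬝ᵥ (M *ᵥ d) = 0) : M = 0 := by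
  ext i j
  simpa [← Pi.single_star] using h (Pi.single i 1) (Pi.single j 1)

/-- The real part of vᴴAv is -vᴴRv, and R ≥ 0; so Rv = 0 and A acts on v through its skew part. -/
theorem SemiDissipative.of_dotProduct_eq_zero (hA : SemiDissipative A) {v : Fin n → ℂ}
    (h : star v ⬝ᵥ (A *ᵥ v) = 0) :
    (-hermPart A) *ᵥ v = 0 ∧ skewPart A *ᵥ v = A *ᵥ v ∧ Aᴴ *ᵥ v = -(A *ᵥ v) := by
  have h1 : star v ⬝ᵥ (Aᴴ *ᵥ v) = 0 := by
    rw [dotProduct_mulVec, ← star_mulVec]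
    calc star (A *ᵥ v) ⬝ᵥ v = star (A *ᵥ v) ⬝ᵥ star (star v) := by rw [star_star]
      _ = 0 := by rw [star_dotProduct_star, h, star_zero]
  have hR : (-hermPart A) *ᵥ v = 0 := by
    rw [← hA.dotProduct_mulVec_zero_iff v, hermPart, neg_mulVec, smul_mulVec, add_mulVec,
      dotProduct_neg, dotProduct_smul, dotProduct_add, h, h1]
    simp
  have hJ : skewPart A *ᵥ v = A *ᵥ v := by
    conv_rhs => rw [← skewPart_sub_neg_hermPart A, sub_mulVec, hR, sub_zero]
  refine ⟨hR, hJ, ?_⟩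
  have h2 : Aᴴ = -skewPart A - -hermPart A := by
    ext i j
    simp [skewPart, hermPart]
    ring
  rw [h2, sub_mulVec, hR, neg_mulVec, hJ, sub_zero]

theorem isUnit_of_mulVec_eq_zero {k : ℕ} {M : Matrix (Fin k) (Fin k) ℂ}
    (h : ∀ c, M *ᵥ c = 0 → c = 0) : IsUnit M := by
  rw [Matrix.isUnit_iff_isUnit_det, isUnit_iff_ne_zero]
  intro h0
  obtain ⟨v, hv, h1⟩ := Matrix.exists_mulVec_eq_zero_iff.2 h0
  exact hv (h v h1)

/-- Existence of staircase forms of regular semi-dissipative Hamiltonian pencils. -/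
theorem nonempty_pencilStaircaseForm (hE : E.PosSemidef) (hA : SemiDissipative A)
    (hreg : RegularPencil E A) : Nonempty (PencilStaircaseForm E A) := by
  have hinj : ∀ v : Fin n → ℂ, E *ᵥ v = 0 → A *ᵥ v = 0 → v = 0 := by
    intro v h1 h2
    by_contra hv
    obtain ⟨z, hz⟩ := hreg
    exact hz (Matrix.exists_mulVec_eq_zero_iff.1
      ⟨v, hv, by rw [sub_mulVec, smul_mulVec, h1, h2, smul_zero, sub_zero]⟩)
  have hsym : ∀ (X : Matrix (Fin n) (Fin n) ℂ) (x y : EuclideanSpace ℂ (Fin n)),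
      inner ℂ x (toEuclideanLin X y) = inner ℂ (toEuclideanLin Xᴴ x) y := by
    intro X x y
    rw [toEuclideanLin_conjTranspose_eq_adjoint, LinearMap.adjoint_inner_left]
  -- For x in K₄ the number xᴴAx vanishes, so Rx = 0 and Jx = Ax lies in V₁ ≤ Kᗮ; this produces the
  -- zero blocks of J and R. Regularity makes A injective on ker E, whence dim V₁ = dim K₄, that is
  -- n₄ = n₁.
  let K : Submodule ℂ (EuclideanSpace ℂ (Fin n)) := LinearMap.ker (toEuclideanLin E)
  let K₄ : Submodule ℂ (EuclideanSpace ℂ (Fin n)) := K ⊓ Kᗮ.comap (toEuclideanLin A)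
  let K₃ : Submodule ℂ (EuclideanSpace ℂ (Fin n)) := K₄ᗮ ⊓ K
  let V₁ : Submodule ℂ (EuclideanSpace ℂ (Fin n)) := K₄.map (toEuclideanLin A)
  let V₂ : Submodule ℂ (EuclideanSpace ℂ (Fin n)) := V₁ᗮ ⊓ Kᗮ
  have hK4 : K₄ ≤ K := inf_le_left
  have hV1 : V₁ ≤ Kᗮ := by
    rintro _ ⟨x, hx, rfl⟩
    exact hx.2
  have hEK : ∀ v, WithLp.toLp 2 v ∈ K → E *ᵥ v = 0 := by
    intro v hv
    have := LinearMap.mem_ker.1 hv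
    simpa [toLpLin_toLp] using this
  have hker : ∀ v, WithLp.toLp 2 v ∈ K₄ →
      (-hermPart A) *ᵥ v = 0 ∧ skewPart A *ᵥ v = A *ᵥ v ∧ Aᴴ *ᵥ v = -(A *ᵥ v) := by
    intro v hv
    apply hA.of_dotProduct_eq_zero
    have := hv.2 _ hv.1
    simpa [toLpLin_toLp, EuclideanSpace.inner_toLp_toLp, dotProduct_comm] using this
  have hker' : ∀ x ∈ K₄, toEuclideanLin (skewPart A) x = toEuclideanLin A x ∧
      toEuclideanLin Aᴴ x = -toEuclideanLin A x := by
    intro x hx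
    obtain ⟨-, h2, h3⟩ := hker (WithLp.ofLp x) hx
    constructor
    · ext i
      exact congrFun h2 i
    · ext i
      exact congrFun h3 i
  have hinjK4 : ∀ x ∈ K₄, toEuclideanLin A x = 0 → x = 0 := by
    intro x hx h0
    have := hinj (WithLp.ofLp x) (hEK _ hx.1) (by simpa using congrArg WithLp.ofLp h0)
    exact congrArg (WithLp.toLp 2) this
  have hdim14 : Module.finrank ℂ V₁ = Module.finrank ℂ K₄ := by
    have h1 : Function.Injective ((toEuclideanLin A).domRestrict K₄) := by
      rw [injective_iff_map_eq_zero]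
      intro x hx
      exact Subtype.ext (hinjK4 x x.2 hx)
    rw [← LinearMap.finrank_range_of_inj h1, LinearMap.range_domRestrict]
  have hdim1 := Submodule.finrank_add_inf_finrank_orthogonal hV1
  have hdim2 := Submodule.finrank_add_inf_finrank_orthogonal hK4
  have hdim3 := Submodule.finrank_add_finrank_orthogonal K
  rw [finrank_euclideanSpace_fin] at hdim3
  obtain ⟨B₁, h11, m1, e1⟩ := exists_orthonormal_columns V₁ rfl
  obtain ⟨B₂, h22, m2, e2⟩ := exists_orthonormal_columns V₂ rfl
  obtain ⟨B₃, h33, m3, e3⟩ := exists_orthonormal_columns K₃ rfl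
  obtain ⟨B₄, h44, m4, e4⟩ := exists_orthonormal_columns K₄ hdim14.symm
  have horth : ∀ {a b : ℕ} {B : Matrix (Fin n) (Fin a) ℂ} {C : Matrix (Fin n) (Fin b) ℂ}
      (X : Matrix (Fin n) (Fin n) ℂ),
      (∀ c d, inner ℂ (WithLp.toLp 2 (B *ᵥ c)) (toEuclideanLin X (WithLp.toLp 2 (C *ᵥ d))) = 0) →
      Bᴴ * X * C = 0 := by
    intro a b B C X h
    refine eq_zero_of_star_dotProduct_mulVec fun c d => ?_
    rw [star_dotProduct_mulVec_eq_inner, h]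
  have horth1 : ∀ {a b : ℕ} {B : Matrix (Fin n) (Fin a) ℂ} {C : Matrix (Fin n) (Fin b) ℂ},
      (∀ c d, inner ℂ (WithLp.toLp 2 (B *ᵥ c)) (WithLp.toLp 2 (C *ᵥ d)) = 0) → Bᴴ * C = 0 := by
    intro a b B C h
    have := horth (B := B) (C := C) 1 fun c d => by simpa [toLpLin_toLp] using h c d
    rwa [Matrix.mul_one] at this
  have hcol : ∀ {b : ℕ} {C : Matrix (Fin n) (Fin b) ℂ} (X : Matrix (Fin n) (Fin n) ℂ),
      (∀ d, X *ᵥ (C *ᵥ d) = 0) → X * C = 0 := by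
    intro b C X h
    refine eq_zero_of_star_dotProduct_mulVec fun c d => ?_
    rw [← mulVec_mulVec, h, dotProduct_zero]
  have hJB : ∀ d, toEuclideanLin (skewPart A) (WithLp.toLp 2 (B₄ *ᵥ d)) ∈ V₁ := fun d => by
    rw [(hker' _ (m4 d)).1]
    exact ⟨_, m4 d, rfl⟩
  refine nonempty_staircaseForm_of_columns hE.1 ?_ hA.1 ?_ h11 h22 h33 h44 ?_ ?_ ?_ ?_ ?_ ?_
    ?_ ?_ ?_ ?_ ?_ ?_ ?_ ?_ ?_
  · ext i j
    simp [skewPart]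
    ring
  · change Module.finrank ℂ V₁ + Module.finrank ℂ V₂ = _ at hdim1
    change Module.finrank ℂ K₄ + Module.finrank ℂ K₃ = _ at hdim2
    omega
  · exact horth1 fun c d => (m2 d).1 _ (m1 c)
  · exact horth1 fun c d => Submodule.inner_left_of_mem_orthogonal (m3 d).2 (hV1 (m1 c))
  · exact horth1 fun c d => Submodule.inner_left_of_mem_orthogonal (hK4 (m4 d)) (hV1 (m1 c))
  · exact horth1 fun c d => Submodule.inner_left_of_mem_orthogonal (m3 d).2 (m2 c).2
  · exact horth1 fun c d => Submodule.inner_left_of_mem_orthogonal (hK4 (m4 d)) (m2 c).2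
  · exact horth1 fun c d => Submodule.inner_left_of_mem_orthogonal (m4 d) (m3 c).1
  · exact hcol _ fun d => hEK _ (m3 d).2
  · exact hcol _ fun d => hEK _ (hK4 (m4 d))
  · exact hcol _ fun d => (hker _ (m4 d)).1
  · exact horth _ fun c d => Submodule.inner_left_of_mem_orthogonal (hJB d) (m2 c).1
  · exact horth _ fun c d => hV1 (hJB d) _ (m3 c).2
  · exact horth _ fun c d => hV1 (hJB d) _ (hK4 (m4 c))
  -- The columns of B₁ and B₂ lie in Kᗮ, which meets ker E only in 0.
  · have h1 := hE.conjTranspose_mul_mul_same (fromCols B₁ B₂)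
    have h2 : (fromCols B₁ B₂)ᴴ * E * fromCols B₁ B₂ = fromBlocks (B₁ᴴ * E * B₁) (B₁ᴴ * E * B₂)
        (B₂ᴴ * E * B₁) (B₂ᴴ * E * B₂) := by
      rw [conjTranspose_fromCols_eq_fromRows_conjTranspose, fromRows_mul, fromRows_mul_fromCols]
    have h12 : B₁ᴴ * B₂ = 0 := horth1 fun c d => (m2 d).1 _ (m1 c)
    have h21 : B₂ᴴ * B₁ = 0 := by simpa using congrArg conjTranspose h12
    have hB : (fromCols B₁ B₂)ᴴ * fromCols B₁ B₂ = 1 := by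
      rw [conjTranspose_fromCols_eq_fromRows_conjTranspose, fromRows_mul_fromCols, h11, h22, h12,
        h21, fromBlocks_one]
    rw [← h2]
    refine PosDef.of_dotProduct_mulVec_pos h1.1 fun x hx => ?_
    refine lt_of_le_of_ne (h1.dotProduct_mulVec_nonneg x) fun h0 => hx ?_
    have h3 : E *ᵥ (fromCols B₁ B₂ *ᵥ x) = 0 := by
      rw [← hE.dotProduct_mulVec_zero_iff, h0, star_mulVec, ← dotProduct_mulVec, mulVec_mulVec,
        mulVec_mulVec, Matrix.mul_assoc]
    have h4 : WithLp.toLp 2 (fromCols B₁ B₂ *ᵥ x) ∈ K := by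
      rw [LinearMap.mem_ker, toLpLin_toLp, toLin'_apply, h3]
      rfl
    have h5 : WithLp.toLp 2 (fromCols B₁ B₂ *ᵥ x) ∈ Kᗮ := by
      rw [fromCols_mulVec, WithLp.toLp_add]
      exact add_mem (hV1 (m1 _)) (m2 _).2
    have h6 : WithLp.toLp 2 (fromCols B₁ B₂ *ᵥ x) = 0 :=
      inner_self_eq_zero.1 (h5 _ h4)
    have h7 : fromCols B₁ B₂ *ᵥ x = 0 := congrArg WithLp.ofLp h6
    have h8 := congrArg ((fromCols B₁ B₂)ᴴ *ᵥ ·) h7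
    simpa only [mulVec_mulVec, hB, one_mulVec, mulVec_zero] using h8
  -- The vector J(B₄c) lies in V₁; if it is orthogonal to V₁ it is 0, and A is injective on K₄.
  · refine isUnit_of_mulVec_eq_zero fun c hc => ?_
    have h1 : toEuclideanLin (skewPart A) (WithLp.toLp 2 (B₄ *ᵥ c)) = 0 := by
      obtain ⟨d, hd⟩ := e1 _ (hJB c)
      rw [← inner_self_eq_zero (𝕜 := ℂ)]
      conv_lhs => enter [2]; rw [hd]
      rw [← star_dotProduct_mulVec_eq_inner, hc, dotProduct_zero]
    rw [(hker' _ (m4 c)).1] at h1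
    have h2 : B₄ *ᵥ c = 0 := congrArg WithLp.ofLp (hinjK4 _ (m4 c) h1)
    have h3 := congrArg (B₄ᴴ *ᵥ ·) h2
    simpa only [mulVec_mulVec, h44, one_mulVec, mulVec_zero] using h3
  · rw [skewPart_sub_neg_hermPart]
    refine isUnit_of_mulVec_eq_zero fun c hc => ?_
    set x := WithLp.toLp 2 (B₃ *ᵥ c) with hx
    -- By hypothesis Ax is orthogonal to K₃. It is also orthogonal to K₄, because Aᴴy = -Ay lies in
    -- Kᗮ for y in K₄. Hence Ax ⊥ K and x lies in K₄ ∩ K₄ᗮ = 0.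
    have h1 : x ∈ K₄ := by
      refine ⟨(m3 c).2, fun y hy => ?_⟩
      rw [← Submodule.sup_orthogonal_inf_of_hasOrthogonalProjection hK4] at hy
      obtain ⟨y₄, hy₄, y₃, hy₃, rfl⟩ := Submodule.mem_sup.1 hy
      obtain ⟨d, rfl⟩ := e3 y₃ hy₃
      rw [inner_add_left, ← star_dotProduct_mulVec_eq_inner, hc, dotProduct_zero, add_zero, hsym,
        (hker' _ hy₄).2, inner_neg_left,
        Submodule.inner_left_of_mem_orthogonal (m3 c).2 hy₄.2, neg_zero]
    have h2 : x = 0 := inner_self_eq_zero.1 ((m3 c).1 _ h1)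
    have h3 : B₃ *ᵥ c = 0 := congrArg WithLp.ofLp h2
    have h4 := congrArg (B₃ᴴ *ᵥ ·) h3
    simpa only [mulVec_mulVec, h33, one_mulVec, mulVec_zero] using h4

end Staircase

/-! ### Solution sets of the generalized Lyapunov equation -/

namespace AlmostKroneckerForm

variable {n : ℕ} {E A W : Matrix (Fin n) (Fin n) ℂ} {S : PencilStaircaseForm E A}

theorem exists_genLyapunov (K : AlmostKroneckerForm S) (h5 : S.n₅ = 0)
    (hK : IsHurwitz (K.E22⁻¹ * K.A22)) (W : Matrix (Fin n) (Fin n) ℂ) :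
    ∃ X, GenLyapunov E A W X := by
  have hE1 := (Matrix.isUnit_iff_isUnit_det _).1 K.E11_posDef.isUnit
  obtain ⟨Y22, hY22, -⟩ := K.existsUnique_solvesDyn hK W
  -- For an arbitrary W symmetry is not required, so Y₄₁ = 0 is allowed and Y₁₄ carries all of Ŵ₁₁.
  refine ⟨_, (K.genLyapunov_back_iff h5 (Y14 := K.E11⁻¹ * K.W11 W) (Y33 := 0) (Y34 := 0)
    (Y41 := 0) (Y43 := 0) (Y44 := 0)).2
    ⟨⟨rfl, rfl, rfl, rfl, rfl, rfl, rfl⟩, hY22, ?_, rfl, rfl⟩⟩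
  rw [mul_nonsing_inv_cancel_left _ _ hE1, Matrix.zero_mul, add_zero]

/-- The solution set of the generalized Lyapunov equation. -/
theorem genLyapunov_iff (K : AlmostKroneckerForm S) (h5 : S.n₅ = 0)
    (X : Matrix (Fin n) (Fin n) ℂ) :
    GenLyapunov E A W X ↔
      ∃ (Y14 Y41 Y44 : Matrix (Fin S.n₁) (Fin S.n₁) ℂ) (Y22 : Matrix (Fin S.n₂) (Fin S.n₂) ℂ)
        (Y24 : Matrix (Fin S.n₂) (Fin S.n₁) ℂ) (Y42 : Matrix (Fin S.n₁) (Fin S.n₂) ℂ)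
        (Y33 : Matrix (Fin S.n₃) (Fin S.n₃) ℂ) (Y34 : Matrix (Fin S.n₃) (Fin S.n₁) ℂ)
        (Y43 : Matrix (Fin S.n₁) (Fin S.n₃) ℂ),
        K.SolvesDyn W Y22 ∧
        K.E11 * Y14 + Y41 * K.E11 = K.W11 W ∧
        Y24 = K.E22⁻¹ * K.W21 W ∧
        Y42 = K.W12 W * K.E22⁻¹ ∧
        X = K.back (blocks4
          0   0   0   Y14
          0   Y22 0   Y24
          0   0   Y33 Y34
          Y41 Y42 Y43 Y44) := by
  constructor
  · intro hX
    obtain ⟨Y, rfl⟩ := K.exists_back_eq h5 X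
    obtain ⟨a11, a12, a13, a14, a21, a22, a23, a24, a31, a32, a33, a34, a41, a42, a43, a44, rfl⟩ :=
      exists_eq_blocks4 Y
    rw [K.genLyapunov_back_iff h5] at hX
    obtain ⟨⟨rfl, rfl, rfl, rfl, rfl, rfl, rfl⟩, h1, h2, h3, h4⟩ := hX
    exact ⟨a14, a41, a44, a22, a24, a42, a33, a34, a43, h1, h2, h3, h4, rfl⟩
  · rintro ⟨Y14, Y41, Y44, Y22, Y24, Y42, Y33, Y34, Y43, h1, h2, h3, h4, rfl⟩
    exact (K.genLyapunov_back_iff h5).2 ⟨⟨rfl, rfl, rfl, rfl, rfl, rfl, rfl⟩, h1, h2, h3, h4⟩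

/-- The Hermitian solutions of the generalized Lyapunov equation. -/
theorem isHermitian_and_genLyapunov_iff (K : AlmostKroneckerForm S) (h5 : S.n₅ = 0)
    (hW : W.IsHermitian) (X : Matrix (Fin n) (Fin n) ℂ) :
    (X.IsHermitian ∧ GenLyapunov E A W X) ↔
      ∃ (Y14 Y44 : Matrix (Fin S.n₁) (Fin S.n₁) ℂ) (Y22 : Matrix (Fin S.n₂) (Fin S.n₂) ℂ)
        (Y24 : Matrix (Fin S.n₂) (Fin S.n₁) ℂ) (Y33 : Matrix (Fin S.n₃) (Fin S.n₃) ℂ)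
        (Y34 : Matrix (Fin S.n₃) (Fin S.n₁) ℂ),
        Y22.IsHermitian ∧ Y33.IsHermitian ∧ Y44.IsHermitian ∧
        K.SolvesDyn W Y22 ∧
        K.E11 * Y14 + Y14ᴴ * K.E11 = K.W11 W ∧
        Y24 = K.E22⁻¹ * K.W21 W ∧
        X = K.back (blocks4
          0    0    0    Y14
          0    Y22  0    Y24
          0    0    Y33  Y34
          Y14ᴴ Y24ᴴ Y34ᴴ Y44) := by
  rw [K.genLyapunov_iff h5]
  constructor
  · rintro ⟨hX, Y14, Y41, Y44, Y22, Y24, Y42, Y33, Y34, Y43, h1, h2, h3, h4, rfl⟩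
    rw [K.back_isHermitian_iff h5, blocks4_conjTranspose, blocks4_inj] at hX
    obtain ⟨-, -, -, -, -, e22, -, -, -, -, e33, -, rfl, rfl, rfl, e44⟩ := hX
    exact ⟨Y14, Y44, Y22, Y24, Y33, Y34, e22, e33, e44, h1, h2, h3, rfl⟩
  · rintro ⟨Y14, Y44, Y22, Y24, Y33, Y34, e22, e33, e44, h1, h2, h3, rfl⟩
    refine ⟨?_, Y14, _, Y44, Y22, Y24, _, Y33, Y34, _, h1, h2, h3, ?_, rfl⟩
    · rw [K.back_isHermitian_iff h5, blocks4_conjTranspose, blocks4_inj]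
      simp [e22.eq, e33.eq, e44.eq]
    · rw [h3, conjTranspose_mul, K.W21_conjTranspose hW, conjTranspose_nonsing_inv,
        K.E22_posDef.isHermitian.eq]

theorem posSemidef_Y14 (K : AlmostKroneckerForm S) (h5 : S.n₅ = 0)
    {Y : Matrix (Fin S.n₁) (Fin S.n₁) ℂ} (hY : Y.IsHermitian)
    (h : K.E11 * Y + Yᴴ * K.E11 = K.W11 W) (hW : W.PosSemidef) : Y.PosSemidef :=
  (isHurwitz_neg_of_posDef K.E11_posDef).posSemidef_of_lyapunov (K.W11_posSemidef h5 hW)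
    ((K.hermitian_E11_iff hY).1 h)

theorem posDef_Y14 (K : AlmostKroneckerForm S) (h5 : S.n₅ = 0)
    {Y : Matrix (Fin S.n₁) (Fin S.n₁) ℂ} (hY : Y.IsHermitian)
    (h : K.E11 * Y + Yᴴ * K.E11 = K.W11 W) (hW : W.PosDef) : Y.PosDef :=
  (isHurwitz_neg_of_posDef K.E11_posDef).posDef_of_lyapunov (K.W11_posDef h5 hW)
    ((K.hermitian_E11_iff hY).1 h)

end AlmostKroneckerForm

end DHDAE

/-! ### Assembly of the theorem -/

theorem mainTheorem7 {n : ℕ} (E A : Matrix (Fin n) (Fin n) ℂ)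
    (hDAE : DHDAE.IsSemiDissipativeHamiltonian E A)
    (hreg : DHDAE.RegularPencil E A)
    (hHC : DHDAE.hcIndex E A ≠ ⊤) :
    -- solvability for every right-hand side
    (∀ W : Matrix (Fin n) (Fin n) ℂ, ∃ X, DHDAE.GenLyapunov E A W X) ∧
    -- uniqueness of `Eᴴ X E`
    (∀ W X X' : Matrix (Fin n) (Fin n) ℂ,
      DHDAE.GenLyapunov E A W X → DHDAE.GenLyapunov E A W X' → Eᴴ * X * E = Eᴴ * X' * E) ∧
    -- definiteness on the image of the spectral projection
    (∃! Pl : Matrix (Fin n) (Fin n) ℂ, DHDAE.IsLeftSpectralProjection E A Pl) ∧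
    (∀ Pl W X : Matrix (Fin n) (Fin n) ℂ,
      DHDAE.IsLeftSpectralProjection E A Pl → DHDAE.GenLyapunov E A W X →
        (W.PosSemidef → DHDAE.PosSemidefOn X (DHDAE.image Pl)) ∧
        (W.PosDef → DHDAE.PosDefOn X (DHDAE.image Pl))) ∧
    -- description of the solution set through the staircase form
    Nonempty (DHDAE.PencilStaircaseForm E A) ∧
    ∀ S : DHDAE.PencilStaircaseForm E A,
      S.n₅ = 0 ∧ Nonempty (DHDAE.AlmostKroneckerForm S) ∧
      ∀ (K : DHDAE.AlmostKroneckerForm S) (W : Matrix (Fin n) (Fin n) ℂ),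
        -- the block `Y₂₂`
        (∃! Y22 : Matrix (Fin S.n₂) (Fin S.n₂) ℂ, K.SolvesDyn W Y22) ∧
        (∀ Y22 : Matrix (Fin S.n₂) (Fin S.n₂) ℂ, K.SolvesDyn W Y22 →
          (W.PosSemidef → Y22.PosSemidef) ∧ (W.PosDef → Y22.PosDef)) ∧
        -- all solutions
        (∀ X : Matrix (Fin n) (Fin n) ℂ, DHDAE.GenLyapunov E A W X ↔
          ∃ (Y14 Y41 Y44 : Matrix (Fin S.n₁) (Fin S.n₁) ℂ) (Y22 : Matrix (Fin S.n₂) (Fin S.n₂) ℂ)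
            (Y24 : Matrix (Fin S.n₂) (Fin S.n₁) ℂ) (Y42 : Matrix (Fin S.n₁) (Fin S.n₂) ℂ)
            (Y33 : Matrix (Fin S.n₃) (Fin S.n₃) ℂ) (Y34 : Matrix (Fin S.n₃) (Fin S.n₁) ℂ)
            (Y43 : Matrix (Fin S.n₁) (Fin S.n₃) ℂ),
            K.SolvesDyn W Y22 ∧
            K.E11 * Y14 + Y41 * K.E11 = K.W11 W ∧
            Y24 = K.E22⁻¹ * K.W21 W ∧
            Y42 = K.W12 W * K.E22⁻¹ ∧
            X = K.back (DHDAE.blocks4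
              0   0   0   Y14
              0   Y22 0   Y24
              0   0   Y33 Y34
              Y41 Y42 Y43 Y44)) ∧
        -- all Hermitian solutions, for Hermitian right-hand side
        (W.IsHermitian →
          (∀ X : Matrix (Fin n) (Fin n) ℂ, (X.IsHermitian ∧ DHDAE.GenLyapunov E A W X) ↔
            ∃ (Y14 Y44 : Matrix (Fin S.n₁) (Fin S.n₁) ℂ) (Y22 : Matrix (Fin S.n₂) (Fin S.n₂) ℂ)
              (Y24 : Matrix (Fin S.n₂) (Fin S.n₁) ℂ) (Y33 : Matrix (Fin S.n₃) (Fin S.n₃) ℂ)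
              (Y34 : Matrix (Fin S.n₃) (Fin S.n₁) ℂ),
              Y22.IsHermitian ∧ Y33.IsHermitian ∧ Y44.IsHermitian ∧
              K.SolvesDyn W Y22 ∧
              K.E11 * Y14 + Y14ᴴ * K.E11 = K.W11 W ∧
              Y24 = K.E22⁻¹ * K.W21 W ∧
              X = K.back (DHDAE.blocks4
                0    0    0    Y14
                0    Y22  0    Y24
                0    0    Y33  Y34
                Y14ᴴ Y24ᴴ Y34ᴴ Y44)) ∧
          (∃! Y14 : Matrix (Fin S.n₁) (Fin S.n₁) ℂ,
            Y14.IsHermitian ∧ K.E11 * Y14 + Y14ᴴ * K.E11 = K.W11 W) ∧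
          (∀ Y14 : Matrix (Fin S.n₁) (Fin S.n₁) ℂ,
            Y14.IsHermitian → K.E11 * Y14 + Y14ᴴ * K.E11 = K.W11 W →
            (W.PosSemidef → Y14.PosSemidef) ∧ (W.PosDef → Y14.PosDef))) := by
  have hst := DHDAE.pencilStable_of_hcIndex hDAE.2 hreg hHC
  obtain ⟨S₀⟩ := DHDAE.nonempty_pencilStaircaseForm hDAE.1 hDAE.2 hreg
  obtain ⟨K₀, -, -⟩ := S₀.exists_almostKroneckerForm
  have h₀ := S₀.n₅_eq_zero hreg
  have hK₀ := (K₀.pencilStable_iff h₀).1 hst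
  obtain ⟨Pl₀, hPl₀⟩ := K₀.exists_isLeftSpectralProjection h₀
  refine ⟨K₀.exists_genLyapunov h₀ hK₀, fun W X X' => K₀.conjTranspose_mul_mul_unique h₀ hK₀,
    ⟨Pl₀, hPl₀, fun Pl hPl => hPl.unique hst.isUnit hPl₀⟩,
    fun Pl W X hPl hX => ⟨hPl.posSemidefOn hst hX, hPl.posDefOn hst hX⟩, ⟨S₀⟩, fun S => ?_⟩
  have h5 := S.n₅_eq_zero hreg
  refine ⟨h5, ⟨S.exists_almostKroneckerForm.choose⟩, fun K W => ?_⟩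
  -- The dynamic part of an arbitrary `K` is Hurwitz because stability belongs to the pencil,
  -- whichever staircase form has finite index.
  have hK := (K.pencilStable_iff h5).1 hst
  exact ⟨K.existsUnique_solvesDyn hK W,
    fun Y hY => ⟨fun hW => K.posSemidef_of_solvesDyn h5 hK hW hY,
      fun hW => K.posDef_of_solvesDyn h5 hK hW hY⟩,
    K.genLyapunov_iff h5,
    fun hW => ⟨K.isHermitian_and_genLyapunov_iff h5 hW, K.existsUnique_isHermitian_Y14 hW,
      fun Y hY h => ⟨K.posSemidef_Y14 h5 hY h, K.posDef_Y14 h5 hY h⟩⟩⟩
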